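/- **Setting.** Let $f:\mathbb R^d\to\mathbb R$ be twice differentiable with $\inf f=f^*>-\infty$, and let the coordinates be split into two nonempty blocks, $\mathbf x=(\mathbf x_1,\mathbf x_2)$, with partial gradients $\nabla_1 f,\nabla_2 f$. Assume that $f$ is $L$-smooth ($\nabla f$ is $L$-Lipschitz), that $\nabla_k f$ is $L_k$-Lipschitz in $\mathbf x_k$ for fixed other block and $\widetilde L_k$-Lipschitz in the other block for fixed $\mathbf x_k$ ($k=1,2$), and that $\nabla^2 f$ is $\rho$-Lipschitz in operator norm, $\rho>0$. Put $L_{\max}=\max\{L_1,L_2,\widetilde L_1,\widetilde L_2\}$ and assume $0<L_{\max}\le L$. **Algorithm (PA-GD).** Given $\mathbf x^{(0)}$, $\epsilon>0$, $\delta\in(0,1]$, $c>0$, put $\Delta_f=f(\mathbf x^{(0)})-f^*$, $\mathcal P_1=1+\frac{L}{L_{\max}}$, $\mathcal P_2=1+\frac{L\log(2d)}{L_{\max}}$, $$\ell=\log\Big(\frac{\mathcal P_1^6\mathcal P_2^2\,d\,L_{\max}^{5/3}\Delta_f}{c^5\rho^{1/3}\epsilon^{7/3}\delta}\Big),\quad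 \chi=6\max\{\ell,4\},\quad \eta=\frac{c}{L_{\max}},\quad r=\frac{c^3}{\chi^3}\frac{\epsilon}{L_{\max}\mathcal P_1^3\mathcal P_2},$$ $$g_{\rm th}=\frac{c^2\epsilon}{(\chi\mathcal P_1)^3\mathcal P_2},\quad f_{\rm th}=\frac{c^5\epsilon^2}{L_{\max}(\chi\mathcal P_1)^6\mathcal P_2^2},\quad t_{\rm th}=\frac{L_{\max}\chi\mathcal P_1}{c^2(L_{\max}\rho\epsilon)^{1/3}}$$ (if $\Delta_f=0$, then $\max\{\ell,4\}=4$). In iteration $t=0,1,2,\dots$ with current iterate $\mathbf x=\mathbf x^{(t)}$: (i) if $\|\nabla_1 f(\mathbf x_1,\mathbf x_2)\|^2+\|\nabla_2 f(\mathbf x_1-\eta\nabla_1f(\mathbf x),\mathbf x_2)\|^2\le g_{\rm th}^2$ and either no perturbation has been made yet or $t-t_{\rm p}>\lceil t_{\rm th}\rceil$, then set $\widetilde{\mathbf x}\leftarrow\mathbf x$, $t_{\rm p}\leftarrow t$ and $\mathbf x\leftarrow\widetilde{\mathbf x}+\xi^{(t)}$, where the $\xi^{(t)}$ are independent and uniform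 on the ball of radius $r$ centered at $0$; (ii) if a perturbation has been made, $t-t_{\rm p}=\lceil t_{\rm th}\rceil$ and $f(\mathbf x)-f(\widetilde{\mathbf x})>-f_{\rm th}$, return $\widetilde{\mathbf x}$ and stop; (iii) otherwise update $\mathbf x_1\leftarrow\mathbf x_1-\eta\nabla_1 f(\mathbf x_1,\mathbf x_2)$, then $\mathbf x_2\leftarrow\mathbf x_2-\eta\nabla_2 f(\mathbf x_1,\mathbf x_2)$ with the new $\mathbf x_1$; the result is $\mathbf x^{(t+1)}$. **Theorem.** There is an absolute constant $c_{\max}>0$, and for every $0<c\le c_{\max}$ a constant $C>0$ depending only on $c$, such that in the above setting, for all $\mathbf x^{(0)}$, all $\delta\in(0,1]$ and all $0<\epsilon\le L_{\max}^2/\rho$, with probability at least $1-\delta$ PA-GD stops and returns a point $\mathbf x$ with $$\|\nabla f(\mathbf x)\|\le\epsilon\quad\text{and}\quad\lambda_{\min}(\nabla^2 f(\mathbf x))\ge-(L_{\max}\rho\epsilon)^{1/3},$$ after a number $T$ of iterations satisfying $$T\le C\left(\frac{L_{\max}^{5/3}\mathcal P_1^7\mathcal P_2^2\Delta_f}{\rho^{1/3}\epsilon^{7/3}}\max\{\ell,4\}^7+t_{\rm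 th}\right);$$ in particular, if moreover $\Delta_f\ge\epsilon^2/L_{\max}$, then $$T\le C\,\frac{L_{\max}^{5/3}\mathcal P_1^7\mathcal P_2^2\Delta_f}{\rho^{1/3}\epsilon^{7/3}}\,\log^7\Big(\frac{\mathcal P_1^6\mathcal P_2^2\,d\,L_{\max}^{5/3}\Delta_f}{c^5\rho^{1/3}\epsilon^{7/3}\delta}\Big).$$ -/

import Mathlib

open MeasureTheory ProbabilityTheory

/-! ### Two-block structure and regularity of the objective -/

/-- The `k`-th block of `x`, padded with zeros. The map `blk` assigns each coordinate to one of the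
two blocks, `0` (first) and `1` (second). -/
noncomputable def blockPart {d : ℕ} (blk : Fin d → Fin 2) (k : Fin 2)
    (x : EuclideanSpace ℝ (Fin d)) : EuclideanSpace ℝ (Fin d) :=
  WithLp.toLp 2 (fun i => if blk i = k then x i else 0)

/-- The partial gradient of `f` in block `k` at `x` (padded with zeros). -/
noncomputable def blockGrad {d : ℕ} (blk : Fin d → Fin 2) (f : EuclideanSpace ℝ (Fin d) → ℝ)
    (k : Fin 2) (x : EuclideanSpace ℝ (Fin d)) : EuclideanSpace ℝ (Fin d) :=
  blockPart blk k (gradient f x)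

/-- The Hessian of `f` at `x`, as a linear operator. -/
noncomputable def hessian {d : ℕ} (f : EuclideanSpace ℝ (Fin d) → ℝ)
    (x : EuclideanSpace ℝ (Fin d)) : EuclideanSpace ℝ (Fin d) →L[ℝ] EuclideanSpace ℝ (Fin d) :=
  fderiv ℝ (gradient f) x

/-- `f` is `L`-smooth. -/
def IsLSmooth {d : ℕ} (f : EuclideanSpace ℝ (Fin d) → ℝ) (L : ℝ) : Prop :=
  Differentiable ℝ f ∧ ∀ x y, ‖gradient f x - gradient f y‖ ≤ L * ‖x - y‖

/-- `f` is block-wise smooth: the `k`-th partial gradient is `Lb k`-Lipschitz in the `k`-th block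
(the other block being fixed) and `Lt k`-Lipschitz in the other block (the `k`-th being fixed). -/
def IsBlockSmooth {d : ℕ} (blk : Fin d → Fin 2) (f : EuclideanSpace ℝ (Fin d) → ℝ)
    (Lb Lt : Fin 2 → ℝ) : Prop :=
  Differentiable ℝ f ∧
  (∀ (k : Fin 2) (x y : EuclideanSpace ℝ (Fin d)), (∀ i, blk i ≠ k → x i = y i) →
    ‖blockGrad blk f k x - blockGrad blk f k y‖ ≤ Lb k * ‖x - y‖) ∧
  (∀ (k : Fin 2) (x y : EuclideanSpace ℝ (Fin d)), (∀ i, blk i = k → x i = y i) →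
    ‖blockGrad blk f k x - blockGrad blk f k y‖ ≤ Lt k * ‖x - y‖)

/-- `f` is twice differentiable with `ρ`-Lipschitz Hessian (in operator norm). -/
def IsHessianLipschitz {d : ℕ} (f : EuclideanSpace ℝ (Fin d) → ℝ) (ρ : ℝ) : Prop :=
  Differentiable ℝ f ∧ Differentiable ℝ (gradient f) ∧
    ∀ x y, ‖hessian f x - hessian f y‖ ≤ ρ * ‖x - y‖

/-- The largest of the four block-wise Lipschitz constants. -/
noncomputable def blockLmax (Lb Lt : Fin 2 → ℝ) : ℝ :=
  max (max (Lb 0) (Lb 1)) (max (Lt 0) (Lt 1))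

/-- `x` is an `(ε, γ)`-second-order stationary point: `‖∇f(x)‖ ≤ ε` and `λ_min(∇²f(x)) ≥ -γ`,
i.e. every eigenvalue of the Hessian is at least `-γ`. -/
def IsSS2 {d : ℕ} (f : EuclideanSpace ℝ (Fin d) → ℝ) (ε γ : ℝ)
    (x : EuclideanSpace ℝ (Fin d)) : Prop :=
  ‖gradient f x‖ ≤ ε ∧
    ∀ μ : ℝ, Module.End.HasEigenvalue
      (hessian f x : EuclideanSpace ℝ (Fin d) →ₗ[ℝ] EuclideanSpace ℝ (Fin d)) μ → -γ ≤ μ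

/-! ### The algorithm -/

/-- The input parameters of perturbed alternating gradient descent; `Δ` is the initial
optimality gap. -/
structure PAGDParams where
  d : ℕ
  c : ℝ
  Lmax : ℝ
  L : ℝ
  ρ : ℝ
  ε : ℝ
  δ : ℝ
  Δ : ℝ

namespace PAGDParams

noncomputable def P₁ (p : PAGDParams) : ℝ := 1 + p.L / p.Lmax

noncomputable def P₂ (p : PAGDParams) : ℝ := 1 + p.L * Real.log (2 * (p.d : ℝ)) / p.Lmax

/-- The curvature tolerance `γ = (L_max ρ ε)^{1/3}`. -/
noncomputable def γ (p : PAGDParams) : ℝ := (p.Lmax * p.ρ * p.ε) ^ ((1 : ℝ) / 3)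

/-- The logarithm of `P₁⁶ P₂² d L_max^{5/3} Δ / (c⁵ ρ^{1/3} ε^{7/3} δ)`. -/
noncomputable def logFactor (p : PAGDParams) : ℝ :=
  Real.log (p.P₁ ^ 6 * p.P₂ ^ 2 * (p.d : ℝ) * p.Lmax ^ ((5 : ℝ) / 3) * p.Δ /
    (p.c ^ 5 * p.ρ ^ ((1 : ℝ) / 3) * p.ε ^ ((7 : ℝ) / 3) * p.δ))

noncomputable def χ (p : PAGDParams) : ℝ := 6 * max p.logFactor 4

/-- The step size. -/
noncomputable def η (p : PAGDParams) : ℝ := p.c / p.Lmax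

/-- The perturbation radius. -/
noncomputable def r (p : PAGDParams) : ℝ :=
  p.c ^ 3 / p.χ ^ 3 * (p.ε / (p.Lmax * p.P₁ ^ 3 * p.P₂))

/-- The gradient threshold. -/
noncomputable def gth (p : PAGDParams) : ℝ :=
  p.c ^ 2 * p.ε / ((p.χ * p.P₁) ^ 3 * p.P₂)

/-- The objective threshold. -/
noncomputable def fth (p : PAGDParams) : ℝ :=
  p.c ^ 5 * p.ε ^ 2 / (p.Lmax * (p.χ * p.P₁) ^ 6 * p.P₂ ^ 2)

/-- The time threshold, as a real number. The algorithm uses it rounded up. -/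
noncomputable def tth (p : PAGDParams) : ℝ :=
  p.Lmax * p.χ * p.P₁ / (p.c ^ 2 * p.γ)

/-- The factor `L_max^{5/3} P₁⁷ P₂² Δ / (ρ^{1/3} ε^{7/3})` of the iteration bound. -/
noncomputable def rate (p : PAGDParams) : ℝ :=
  p.Lmax ^ ((5 : ℝ) / 3) * p.P₁ ^ 7 * p.P₂ ^ 2 * p.Δ /
    (p.ρ ^ ((1 : ℝ) / 3) * p.ε ^ ((7 : ℝ) / 3))

end PAGDParams

/-- A state of the algorithm at the beginning of an iteration: the current iterate `x`, and, if a
perturbation has already been made, the time `t_p` of the last one together with the iterate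
before that perturbation. -/
structure PAGDState (d : ℕ) where
  x : EuclideanSpace ℝ (Fin d)
  last : Option (ℕ × EuclideanSpace ℝ (Fin d))

/-- The iterate after the update of the first block. -/
noncomputable def agdHalf {d : ℕ} (blk : Fin d → Fin 2) (f : EuclideanSpace ℝ (Fin d) → ℝ)
    (η : ℝ) (x : EuclideanSpace ℝ (Fin d)) : EuclideanSpace ℝ (Fin d) :=
  x - η • blockGrad blk f 0 x

/-- One step of alternating gradient descent: first block, then second block at the updated
first block. -/
noncomputable def agdStep {d : ℕ} (blk : Fin d → Fin 2) (f : EuclideanSpace ℝ (Fin d) → ℝ)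
    (η : ℝ) (x : EuclideanSpace ℝ (Fin d)) : EuclideanSpace ℝ (Fin d) :=
  agdHalf blk f η x - η • blockGrad blk f 1 (agdHalf blk f η x)

/-- The sum of the squared norms of the two partial gradients that an alternating step at `x`
uses. -/
noncomputable def agdGradSq {d : ℕ} (blk : Fin d → Fin 2) (f : EuclideanSpace ℝ (Fin d) → ℝ)
    (η : ℝ) (x : EuclideanSpace ℝ (Fin d)) : ℝ :=
  ‖blockGrad blk f 0 x‖ ^ 2 + ‖blockGrad blk f 1 (agdHalf blk f η x)‖ ^ 2

open Classical in
/-- The perturbation part of iteration `t`, with noise `ξ`: it acts if the partial gradients are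
small and more than `t_th` iterations have passed since the last perturbation (or there was
none). -/
noncomputable def pagdPerturb {d : ℕ} (p : PAGDParams) (blk : Fin d → Fin 2)
    (f : EuclideanSpace ℝ (Fin d) → ℝ) (t : ℕ) (ξ : EuclideanSpace ℝ (Fin d))
    (s : PAGDState d) : PAGDState d :=
  if agdGradSq blk f p.η s.x ≤ p.gth ^ 2 ∧ ∀ q ∈ s.last, q.1 + ⌈p.tth⌉₊ < t then
    ⟨s.x + ξ, some (t, s.x)⟩
  else s

open Classical in
/-- Iteration `t`, with noise `ξ`: possible perturbation, then the stopping test (`t_th` iterations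
after the last perturbation), then an alternating gradient step. The result is either the next
state or the returned point. -/
noncomputable def pagdIter {d : ℕ} (p : PAGDParams) (blk : Fin d → Fin 2)
    (f : EuclideanSpace ℝ (Fin d) → ℝ) (t : ℕ) (ξ : EuclideanSpace ℝ (Fin d))
    (s : PAGDState d) : PAGDState d ⊕ EuclideanSpace ℝ (Fin d) :=
  match (pagdPerturb p blk f t ξ s).last with
  | some (tp, xt) =>
    if t = tp + ⌈p.tth⌉₊ ∧ -p.fth < f (pagdPerturb p blk f t ξ s).x - f xt then
      Sum.inr xt
    else Sum.inl ⟨agdStep blk f p.η (pagdPerturb p blk f t ξ s).x, some (tp, xt)⟩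
  | none => Sum.inl ⟨agdStep blk f p.η (pagdPerturb p blk f t ξ s).x, none⟩

/-- The algorithm started at `x₀` with noise sequence `ξ`, after `T` iterations: either it is still
running, in some state, or it has returned a point. -/
noncomputable def pagdRun {d : ℕ} (p : PAGDParams) (blk : Fin d → Fin 2)
    (f : EuclideanSpace ℝ (Fin d) → ℝ) (x₀ : EuclideanSpace ℝ (Fin d))
    (ξ : ℕ → EuclideanSpace ℝ (Fin d)) : ℕ → PAGDState d ⊕ EuclideanSpace ℝ (Fin d)
  | 0 => Sum.inl ⟨x₀, none⟩
  | t + 1 =>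
    match pagdRun p blk f x₀ ξ t with
    | Sum.inl s => pagdIter p blk f t (ξ t) s
    | Sum.inr y => Sum.inr y

/-- The uniform distribution on the ball of radius `r` centered at the origin. -/
noncomputable def uniformBall (d : ℕ) (r : ℝ) : Measure (EuclideanSpace ℝ (Fin d)) :=
  cond volume (Metric.ball 0 r)

/-! Small steps of alternating gradient descent never increase the objective, and unless both
partial gradients are small they decrease it substantially. A perturbation from which the algorithm
does not return costs at least `f_th` of the objective, so the run ends, after a number of
perturbations and iterations controlled by `Δ / f_th`.

It remains to see that a run is unlikely to get stuck near a point `x` whose Hessian has an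
eigenvalue below `-γ`. Although the linearisation of an alternating step at `x` is not symmetric,
it has a left eigenvector `φ` with a real eigenvalue at least `1 + ηγ / 2`: the eigenvalue is `σ²`,
where `σ` is the largest number for which a symmetric pencil in `σ` is singular, and this choice
also bounds the other modes by the same rate up to a factor growing like the square root of the
time. Two runs whose starting points differ by a multiple of `φ` therefore separate exponentially,
whereas runs that are stuck stay close to `x`. Hence the perturbations leading to a stuck run form
a set that is thin in the direction `φ`. It has many disjoint translates inside a slightly larger
ball, so its probability is small, and a union bound over the random times of the perturbations
concludes. -/

open scoped RealInnerProductSpace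

/-! ### Linear recursions -/

section Sequences

theorem sq_norm_sub_le_of_forall_sq_norm_sub_le {E : Type*} [SeminormedAddCommGroup E]
    {z : ℕ → E} {φ : ℕ → ℝ} {B : ℝ}
    (h : ∀ n, ‖z (n + 1) - z n‖ ^ 2 ≤ B * (φ n - φ (n + 1))) (n : ℕ) :
    ‖z n - z 0‖ ^ 2 ≤ n * (B * (φ 0 - φ n)) :=
  calc ‖z n - z 0‖ ^ 2
      = ‖∑ i ∈ Finset.range n, (z (i + 1) - z i)‖ ^ 2 := by rw [Finset.sum_range_sub]
    _ ≤ (∑ i ∈ Finset.range n, ‖z (i + 1) - z i‖) ^ 2 := by gcongr; exact norm_sum_le _ _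
    _ ≤ n * ∑ i ∈ Finset.range n, ‖z (i + 1) - z i‖ ^ 2 := by
        simpa using sq_sum_le_card_mul_sum_sq (s := Finset.range n)
    _ ≤ n * ∑ i ∈ Finset.range n, B * (φ i - φ (i + 1)) := by gcongr with i; exact h i
    _ = n * (B * (φ 0 - φ n)) := by rw [← Finset.mul_sum, Finset.sum_range_sub']

variable {E : Type*}

theorem eq_pow_apply_add_sum_range {R : Type*} [Semiring R] [AddCommGroup E] [Module R E]
    [TopologicalSpace E] (A : E →L[R] E) (v : ℕ → E) (n : ℕ) :
    v n = (A ^ n) (v 0) + ∑ j ∈ Finset.range n, (A ^ (n - 1 - j)) (v (j + 1) - A (v j)) := by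
  induction n with
  | zero => simp
  | succ n ih =>
    have hsum : ∑ j ∈ Finset.range n, (A ^ (n - j)) (v (j + 1) - A (v j)) =
        A (∑ j ∈ Finset.range n, (A ^ (n - 1 - j)) (v (j + 1) - A (v j))) := by
      rw [map_sum]
      refine Finset.sum_congr rfl fun j hj => ?_
      rw [← mul_apply_eq_comp, ← pow_succ',
        show n - 1 - j + 1 = n - j by have := Finset.mem_range.1 hj; omega]
    rw [Finset.sum_range_succ, Nat.add_sub_cancel, hsum, Nat.sub_self, pow_zero, pow_succ',
      mul_apply_eq_comp, one_apply_eq_self, ← add_assoc, ← map_add, ← ih,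
      add_sub_cancel]

theorem norm_le_of_nearly_linear [SeminormedAddCommGroup E] [NormedSpace ℝ E] {A : E →L[ℝ] E}
    {l C κ : ℝ} (hl : 1 ≤ l) (hC : 0 ≤ C) (hκ : 0 ≤ κ) {K : ℕ}
    (hA : ∀ n ≤ K, ∀ w, ‖(A ^ n) w‖ ≤ C * l ^ n * ‖w‖) {v : ℕ → E}
    (hv : ∀ n < K, ‖v (n + 1) - A (v n)‖ ≤ κ * ‖v n‖) (hκC : 2 * C * κ * K ≤ 1) :
    ∀ n ≤ K, ‖v n‖ ≤ 2 * C * l ^ n * ‖v 0‖ := by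
  intro n
  induction n using Nat.strong_induction_on with
  | _ n ih =>
    intro hn
    have hterm : ∀ j ∈ Finset.range n, ‖(A ^ (n - 1 - j)) (v (j + 1) - A (v j))‖ ≤
        C * (2 * C * κ) * l ^ n * ‖v 0‖ := fun j hj => by
      have hj := Finset.mem_range.1 hj
      calc ‖(A ^ (n - 1 - j)) (v (j + 1) - A (v j))‖
          ≤ C * l ^ (n - 1 - j) * (κ * (2 * C * l ^ j * ‖v 0‖)) := by
            refine (hA _ (by omega) _).trans ?_
            gcongr
            exact (hv j (by omega)).trans (by gcongr; exact ih j hj (by omega))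
        _ = C * (2 * C * κ) * l ^ (n - 1 - j + j) * ‖v 0‖ := by rw [pow_add]; ring
        _ ≤ C * (2 * C * κ) * l ^ n * ‖v 0‖ := by gcongr; omega
    calc ‖v n‖
        ≤ ‖(A ^ n) (v 0)‖ + ∑ j ∈ Finset.range n, ‖(A ^ (n - 1 - j)) (v (j + 1) - A (v j))‖ := by
          rw [eq_pow_apply_add_sum_range A v n]
          exact (norm_add_le _ _).trans (by gcongr; exact norm_sum_le _ _)
      _ ≤ C * l ^ n * ‖v 0‖ + n * (C * (2 * C * κ) * l ^ n * ‖v 0‖) := by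
          refine add_le_add (hA n hn _) ?_
          simpa using Finset.sum_le_sum hterm
      _ = C * l ^ n * ‖v 0‖ * (1 + 2 * C * κ * n) := by ring
      _ ≤ C * l ^ n * ‖v 0‖ * (1 + 1) := by
          have : 2 * C * κ * n ≤ 2 * C * κ * K := by gcongr
          gcongr
          linarith
      _ = 2 * C * l ^ n * ‖v 0‖ := by ring

variable [NormedAddCommGroup E] [InnerProductSpace ℝ E] {A : E →L[ℝ] E} {φ : E} {l : ℝ}

theorem inner_pow_apply_of_left_eigenvector (hφ : ∀ w, ⟪φ, A w⟫ = l * ⟪φ, w⟫) (n : ℕ) (w : E) :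
    ⟪φ, (A ^ n) w⟫ = l ^ n * ⟪φ, w⟫ := by
  induction n with
  | zero => simp
  | succ n ih => rw [pow_succ', mul_apply_eq_comp, hφ, ih]; ring

theorem pow_mul_le_norm_of_nearly_linear {C κ s : ℝ} (hl : 1 ≤ l) (hC : 0 ≤ C) (hκ : 0 ≤ κ)
    (hs : 0 ≤ s) (hφ : ‖φ‖ = 1) (hφA : ∀ w, ⟪φ, A w⟫ = l * ⟪φ, w⟫) {K : ℕ}
    (hA : ∀ n ≤ K, ∀ w, ‖(A ^ n) w‖ ≤ C * l ^ n * ‖w‖) {v : ℕ → E} (hv0 : v 0 = s • φ)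
    (hv : ∀ n < K, ‖v (n + 1) - A (v n)‖ ≤ κ * ‖v n‖) (hκC : 2 * C * κ * K ≤ 1 / 2) :
    l ^ K * s / 2 ≤ ‖v K‖ := by
  have hn0 : ‖v 0‖ = s := by rw [hv0, norm_smul, hφ, mul_one, Real.norm_of_nonneg hs]
  have hgrowth := norm_le_of_nearly_linear hl hC hκ hA hv (by linarith)
  have hexpand : ⟪φ, v K⟫ =
      l ^ K * s + ∑ j ∈ Finset.range K, l ^ (K - 1 - j) * ⟪φ, v (j + 1) - A (v j)⟫ := by
    conv_lhs => rw [eq_pow_apply_add_sum_range A v K]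
    simp only [inner_add_right, inner_sum, inner_pow_apply_of_left_eigenvector hφA, hv0,
      real_inner_smul_right, real_inner_self_eq_norm_sq, hφ, one_pow, mul_one]
  have hterm : ∀ j ∈ Finset.range K,
      -(2 * C * κ * (l ^ K * s)) ≤ l ^ (K - 1 - j) * ⟪φ, v (j + 1) - A (v j)⟫ := fun j hj => by
    have hj := Finset.mem_range.1 hj
    refine neg_le_of_abs_le ?_
    calc |l ^ (K - 1 - j) * ⟪φ, v (j + 1) - A (v j)⟫|
        = l ^ (K - 1 - j) * |⟪φ, v (j + 1) - A (v j)⟫| := by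
          rw [abs_mul, abs_of_nonneg (by positivity)]
      _ ≤ l ^ (K - 1 - j) * (κ * (2 * C * l ^ j * s)) := by
          gcongr
          refine (abs_real_inner_le_norm _ _).trans ?_
          rw [hφ, one_mul, ← hn0]
          exact (hv j hj).trans (by gcongr; exact hgrowth j hj.le)
      _ = 2 * C * κ * (l ^ (K - 1 - j + j) * s) := by rw [pow_add]; ring
      _ ≤ 2 * C * κ * (l ^ K * s) := by gcongr; omega
  have hsum := Finset.sum_le_sum hterm
  rw [Finset.sum_const, Finset.card_range, nsmul_eq_mul] at hsum
  have hsmall : 2 * C * κ * K * (l ^ K * s) ≤ 1 / 2 * (l ^ K * s) := by gcongr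
  have hcs : ⟪φ, v K⟫ ≤ ‖v K‖ := by simpa [hφ] using real_inner_le_norm φ (v K)
  linarith

end Sequences

/-- `p` and `q` are complementary orthogonal projections, such as the projections onto the two
blocks of coordinates. -/
structure IsBlockSplit {E : Type*} [NormedAddCommGroup E] [InnerProductSpace ℝ E]
    (p q : E →L[ℝ] E) : Prop where
  isSymmetricProjection : p.IsSymmetricProjection
  add_eq_one : p + q = 1

namespace IsBlockSplit

variable {E : Type*} [NormedAddCommGroup E] [InnerProductSpace ℝ E] {p q : E →L[ℝ] E}

theorem apply_add_apply (h : IsBlockSplit p q) (x : E) : p x + q x = x := by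
  simpa using DFunLike.congr_fun h.add_eq_one x

theorem left_left (h : IsBlockSplit p q) (x : E) : p (p x) = p x :=
  DFunLike.congr_fun h.isSymmetricProjection.isIdempotentElem x

theorem left_right (h : IsBlockSplit p q) (x : E) : p (q x) = 0 := by
  simpa [h.left_left] using congrArg p (h.apply_add_apply x)

theorem inner_left (h : IsBlockSplit p q) (x y : E) : ⟪p x, y⟫ = ⟪x, p y⟫ :=
  h.isSymmetricProjection.isSymmetric x y

theorem symm (h : IsBlockSplit p q) : IsBlockSplit q p where
  isSymmetricProjection := by
    have hq : q = 1 - p := eq_sub_of_add_eq' h.add_eq_one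
    refine ⟨?_, fun x y => ?_⟩
    · ext x
      change q (q x) = q x
      simpa [h.left_right] using h.apply_add_apply (q x)
    · simp [hq, inner_sub_left, inner_sub_right, h.inner_left]
  add_eq_one := add_comm q p ▸ h.add_eq_one

theorem right_left (h : IsBlockSplit p q) (x : E) : q (p x) = 0 := h.symm.left_right x

theorem right_right (h : IsBlockSplit p q) (x : E) : q (q x) = q x := h.symm.left_left x

theorem inner_right (h : IsBlockSplit p q) (x y : E) : ⟪q x, y⟫ = ⟪x, q y⟫ := h.symm.inner_left x y

theorem inner_left_left (h : IsBlockSplit p q) (x y : E) : ⟪p x, p y⟫ = ⟪x, p y⟫ := by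
  rw [h.inner_left, h.left_left]

theorem sq_norm_add (h : IsBlockSplit p q) (x y : E) :
    ‖p x + q y‖ ^ 2 = ‖p x‖ ^ 2 + ‖q y‖ ^ 2 := by
  rw [norm_add_sq_real, h.inner_left, h.left_right, inner_zero_right]; ring

theorem sq_norm_eq (h : IsBlockSplit p q) (x : E) : ‖x‖ ^ 2 = ‖p x‖ ^ 2 + ‖q x‖ ^ 2 := by
  rw [← h.sq_norm_add, h.apply_add_apply]

theorem norm_left_le (h : IsBlockSplit p q) (x : E) : ‖p x‖ ≤ ‖x‖ := by
  refine (sq_le_sq₀ (norm_nonneg _) (norm_nonneg _)).1 ?_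
  rw [h.sq_norm_eq x]
  exact le_add_of_nonneg_right (sq_nonneg _)

end IsBlockSplit

/-! ### The alternating step of a quadratic form -/

section QuadraticStep

variable {E : Type*} [NormedAddCommGroup E] [InnerProductSpace ℝ E] {p q H G : E →L[ℝ] E}

/-- The alternating gradient step with step size `η` for the quadratic form with operator `H`,
where `p` and `q` are the projections onto the two blocks. -/
noncomputable def altStep (p q H : E →L[ℝ] E) (η : ℝ) : E →L[ℝ] E :=
  (1 - η • (q * H)) * (1 - η • (p * H))

theorem altStep_apply (p q H : E →L[ℝ] E) (η : ℝ) (v : E) :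
    altStep p q H η v = (v - η • p (H v)) - η • q (H (v - η • p (H v))) := by
  simp [altStep]

theorem IsBlockSplit.sq_norm_smul_le_inner_sub (hs : IsBlockSplit p q) (hG : G.IsSymmetric) {τ : ℝ}
    (hτ : ∀ x, τ * ⟪x, G x⟫ ≤ ‖x‖ ^ 2) (z : E) :
    ‖τ • p (G z)‖ ^ 2 ≤
      τ * (⟪z, G z⟫ - ⟪z - τ • p (G z), G (z - τ • p (G z))⟫) := by
  have hself : ⟪p (G z), G z⟫ = ‖p (G z)‖ ^ 2 := by
    rw [real_inner_comm, ← hs.inner_left_left, real_inner_self_eq_norm_sq]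
  have hcross : ⟪z, G (p (G z))⟫ = ‖p (G z)‖ ^ 2 := by
    rw [← hG.apply_clm, real_inner_comm, hself]
  rw [norm_smul, mul_pow, Real.norm_eq_abs, sq_abs]
  simp only [map_sub, map_smul, inner_sub_left, inner_sub_right, real_inner_smul_left,
    real_inner_smul_right, hself, hcross]
  linarith [mul_le_mul_of_nonneg_left (hτ (p (G z))) (sq_nonneg τ)]

theorem IsBlockSplit.sq_norm_altStep_sub_le (hs : IsBlockSplit p q) (hG : G.IsSymmetric) {τ : ℝ}
    (hτ : ∀ x, τ * ⟪x, G x⟫ ≤ ‖x‖ ^ 2) (z : E) :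
    ‖altStep p q G τ z - z‖ ^ 2 ≤
      2 * τ * (⟪z, G z⟫ - ⟪altStep p q G τ z, G (altStep p q G τ z)⟫) := by
  have hfirst := hs.sq_norm_smul_le_inner_sub hG hτ z
  have hsecond := hs.symm.sq_norm_smul_le_inner_sub hG hτ (z - τ • p (G z))
  have hsplit : altStep p q G τ z - z = -(τ • p (G z) + τ • q (G (z - τ • p (G z)))) := by
    rw [altStep_apply]; abel
  have hnorm : ‖altStep p q G τ z - z‖ ^ 2 ≤
      2 * (‖τ • p (G z)‖ ^ 2 + ‖τ • q (G (z - τ • p (G z)))‖ ^ 2) := by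
    rw [hsplit, norm_neg]
    exact (pow_le_pow_left₀ (norm_nonneg _) (norm_add_le _ _) 2).trans add_sq_le
  rw [altStep_apply] at hnorm ⊢
  linarith

/-- The operator with matrix blocks those of `H`, the off-diagonal ones scaled by `σ`, shifted by
`(σ² - 1) / η`. By `IsBlockSplit.altStep_blockScale`, the alternating step for `H` is conjugate to
`σ²` times the alternating step for this symmetric operator, and a kernel vector of the latter is
an eigenvector of the former with eigenvalue `σ²`. -/
noncomputable def growthOp (p q H : E →L[ℝ] E) (η σ : ℝ) : E →L[ℝ] E :=
  p * H * p + q * H * q + σ • (p * H * q + q * H * p) + ((σ ^ 2 - 1) / η) • 1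

/-- The change of coordinates that scales the second block by `σ`. -/
noncomputable def blockScale (p q : E →L[ℝ] E) (σ : ℝ) : E →L[ℝ] E :=
  p + σ • q

theorem growthOp_apply (p q H : E →L[ℝ] E) (η σ : ℝ) (z : E) :
    growthOp p q H η σ z = p (H (p z)) + q (H (q z)) + σ • (p (H (q z)) + q (H (p z))) +
      ((σ ^ 2 - 1) / η) • z := by
  simp [growthOp]

theorem blockScale_apply (p q : E →L[ℝ] E) (σ : ℝ) (z : E) :
    blockScale p q σ z = p z + σ • q z := by
  simp [blockScale]

namespace IsBlockSplit

theorem isSymmetric_growthOp (hs : IsBlockSplit p q) (hH : H.IsSymmetric) (η σ : ℝ) :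
    (growthOp p q H η σ).IsSymmetric := fun x y => by
  simp only [ContinuousLinearMap.coe_coe, growthOp_apply, inner_add_left, inner_add_right,
    real_inner_smul_left, real_inner_smul_right, hs.inner_left, hs.inner_right, hH.apply_clm]
  ring

theorem inner_growthOp_self (hs : IsBlockSplit p q) (η σ : ℝ) (z : E) :
    ⟪z, growthOp p q H η σ z⟫ = σ * ⟪z, H z⟫ +
      (1 - σ) * (⟪p z, H (p z)⟫ + ⟪q z, H (q z)⟫) + (σ ^ 2 - 1) / η * ‖z‖ ^ 2 := by
  have hblocks : ⟪z, H z⟫ =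
      ⟪p z, H (p z)⟫ + ⟪p z, H (q z)⟫ + ⟪q z, H (p z)⟫ + ⟪q z, H (q z)⟫ := by
    conv_lhs => rw [← hs.apply_add_apply z]
    simp only [map_add, inner_add_left, inner_add_right]
    ring
  rw [hblocks]
  simp only [growthOp_apply, inner_add_right, real_inner_smul_right, ← hs.inner_left,
    ← hs.inner_right, real_inner_self_eq_norm_sq]
  ring

end IsBlockSplit

theorem abs_inner_apply_self_le (H : E →L[ℝ] E) (z : E) : |⟪z, H z⟫| ≤ ‖H‖ * ‖z‖ ^ 2 :=
  calc |⟪z, H z⟫| ≤ ‖z‖ * ‖H z‖ := abs_real_inner_le_norm _ _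
    _ ≤ ‖z‖ * (‖H‖ * ‖z‖) := by gcongr; exact H.le_opNorm z
    _ = ‖H‖ * ‖z‖ ^ 2 := by ring

namespace IsBlockSplit

theorem abs_inner_blocks_le (hs : IsBlockSplit p q) (H : E →L[ℝ] E) (z : E) :
    |⟪p z, H (p z)⟫ + ⟪q z, H (q z)⟫| ≤ ‖H‖ * ‖z‖ ^ 2 := by
  rw [hs.sq_norm_eq z, mul_add]
  exact (abs_add_le _ _).trans
    (add_le_add (abs_inner_apply_self_le H _) (abs_inner_apply_self_le H _))

theorem abs_inner_growthOp_self_sub_le (hs : IsBlockSplit p q) {σ : ℝ} (hσ : 1 ≤ σ) (η : ℝ)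
    (z : E) :
    |⟪z, growthOp p q H η σ z⟫ - (σ ^ 2 - 1) / η * ‖z‖ ^ 2| ≤ (2 * σ - 1) * (‖H‖ * ‖z‖ ^ 2) := by
  rw [hs.inner_growthOp_self, add_sub_cancel_right]
  calc |σ * ⟪z, H z⟫ + (1 - σ) * (⟪p z, H (p z)⟫ + ⟪q z, H (q z)⟫)|
      ≤ |σ| * |⟪z, H z⟫| + |1 - σ| * |⟪p z, H (p z)⟫ + ⟪q z, H (q z)⟫| := by
        rw [← abs_mul, ← abs_mul]; exact abs_add_le _ _
    _ ≤ σ * (‖H‖ * ‖z‖ ^ 2) + (σ - 1) * (‖H‖ * ‖z‖ ^ 2) := by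
        rw [abs_of_nonneg (zero_le_one.trans hσ), abs_of_nonpos (sub_nonpos.2 hσ), neg_sub]
        gcongr
        exacts [abs_inner_apply_self_le H z, hs.abs_inner_blocks_le H z]
    _ = (2 * σ - 1) * (‖H‖ * ‖z‖ ^ 2) := by ring

theorem sq_sub_one_div_le_of_inner_growthOp_nonpos (hs : IsBlockSplit p q) {η σ : ℝ}
    (hσ : 1 ≤ σ) {z : E} (hz : z ≠ 0) (hneg : ⟪z, growthOp p q H η σ z⟫ ≤ 0) :
    (σ ^ 2 - 1) / η ≤ (2 * σ - 1) * ‖H‖ := by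
  have hbound := neg_le_of_abs_le (hs.abs_inner_growthOp_self_sub_le (H := H) hσ η z)
  refine le_of_mul_le_mul_right (a := ‖z‖ ^ 2) ?_ (by positivity)
  linarith

theorem le_of_inner_growthOp_nonpos (hs : IsBlockSplit p q) {η σ : ℝ} (hη : 0 < η) (hσ : 1 ≤ σ)
    {z : E} (hz : z ≠ 0) (hneg : ⟪z, growthOp p q H η σ z⟫ ≤ 0) : σ ≤ 1 + 2 * (η * ‖H‖) := by
  have hle := hs.sq_sub_one_div_le_of_inner_growthOp_nonpos hσ hz hneg
  rw [div_le_iff₀ hη] at hle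
  have hnorm : 0 ≤ η * ‖H‖ := by positivity
  by_contra! hlt
  nlinarith

theorem inner_growthOp_nonpos (hs : IsBlockSplit p q) {η γ : ℝ} (hη : 0 < η) (hγ : 0 ≤ γ)
    (hηH : η * ‖H‖ ≤ 1 / 4) {v : E} (hv : ‖v‖ = 1) (hvH : ⟪v, H v⟫ ≤ -γ) :
    ⟪v, growthOp p q H η √(1 + η * γ / 2) v⟫ ≤ 0 := by
  have hσ : 1 ≤ √(1 + η * γ / 2) := Real.one_le_sqrt.2 (by linarith [mul_nonneg hη.le hγ])
  have hσ' : √(1 + η * γ / 2) - 1 ≤ η * γ / 4 := by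
    linarith [Real.sqrt_one_add_le (x := η * γ / 2) (by linarith [mul_nonneg hη.le hγ])]
  have hshift : (√(1 + η * γ / 2) ^ 2 - 1) / η = γ / 2 := by
    rw [Real.sq_sqrt (by linarith [mul_nonneg hη.le hγ])]
    field_simp
    ring
  have hblocks := neg_le_of_abs_le (hs.abs_inner_blocks_le H v)
  rw [hs.inner_growthOp_self, hshift, hv]
  rw [hv, one_pow, mul_one] at hblocks
  generalize √(1 + η * γ / 2) = σ at *
  have hmain : σ * ⟪v, H v⟫ ≤ -γ := by nlinarith
  have hdiag : (1 - σ) * (⟪p v, H (p v)⟫ + ⟪q v, H (q v)⟫) ≤ (σ - 1) * ‖H‖ := by nlinarith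
  have hsmall : (σ - 1) * ‖H‖ ≤ γ / 16 := by nlinarith [norm_nonneg H]
  linarith

end IsBlockSplit

theorem apply_eq_zero_of_isPositive {G : E →L[ℝ] E} (hG : G.IsPositive) {x : E}
    (hx : ⟪x, G x⟫ ≤ 0) : G x = 0 := by
  let B : LinearMap.BilinForm ℝ E := (innerₗ E).comp (G : E →ₗ[ℝ] E)
  have hB : ∀ y z, B y z = ⟪G y, z⟫ := fun _ _ => rfl
  have hcs := B.apply_sq_le_of_symm (fun y => hG.inner_nonneg_left y)
    ⟨fun y z => by simp [hB, hG.inner_left_eq_inner_right, real_inner_comm (G y)]⟩ x (G x)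
  have hx' : B x x ≤ 0 := by rwa [hB, real_inner_comm]
  have hsq : B x (G x) ^ 2 ≤ 0 :=
    hcs.trans (mul_nonpos_of_nonpos_of_nonneg hx' (hG.inner_nonneg_left _))
  rw [← inner_self_eq_zero (𝕜 := ℝ), ← hB]
  exact pow_eq_zero_iff two_ne_zero |>.1 (le_antisymm hsq (sq_nonneg _))

/-- `σ` is the largest number for which `growthOp p q H η σ` is singular: this operator is still
positive semidefinite, but has a kernel. Then `σ²` is the growth factor of the alternating step. -/
structure IsGrowthRoot (p q H : E →L[ℝ] E) (η σ : ℝ) : Prop where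
  one_le : 1 ≤ σ
  isPositive : (growthOp p q H η σ).IsPositive
  exists_ker : ∃ x, x ≠ 0 ∧ growthOp p q H η σ x = 0

theorem IsBlockSplit.continuous_inner_growthOp (hs : IsBlockSplit p q) (H : E →L[ℝ] E) (η : ℝ) :
    Continuous fun a : ℝ × E => ⟪a.2, growthOp p q H η a.1 a.2⟫ := by
  simp only [hs.inner_growthOp_self]
  fun_prop

theorem IsBlockSplit.exists_isGrowthRoot [FiniteDimensional ℝ E] (hs : IsBlockSplit p q)
    (hH : H.IsSymmetric) {η σ₀ : ℝ} (hη : 0 < η) (hσ₀ : 1 ≤ σ₀) {v : E} (hv : ‖v‖ = 1)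
    (hneg : ⟪v, growthOp p q H η σ₀ v⟫ ≤ 0) : ∃ σ, σ₀ ≤ σ ∧ IsGrowthRoot p q H η σ := by
  let g : ℝ × E → ℝ := fun a => ⟪a.2, growthOp p q H η a.1 a.2⟫
  have hg : Continuous g := hs.continuous_inner_growthOp H η
  let S : Set (ℝ × E) :=
    (Set.Icc 1 (1 + 2 * (η * ‖H‖)) ×ˢ Metric.sphere (0 : E) 1) ∩ {a | g a ≤ 0}
  have hmemS : ∀ {σ : ℝ} {z : E}, 1 ≤ σ → ‖z‖ = 1 → g (σ, z) ≤ 0 → (σ, z) ∈ S :=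
    fun hσ hz hgz => ⟨⟨⟨hσ, hs.le_of_inner_growthOp_nonpos hη hσ
      (norm_ne_zero_iff.1 (hz ▸ one_ne_zero)) hgz⟩, mem_sphere_zero_iff_norm.2 hz⟩, hgz⟩
  have hS : IsCompact S :=
    (isCompact_Icc.prod (isCompact_sphere 0 1)).inter_right (isClosed_le hg continuous_const)
  obtain ⟨⟨σ, x⟩, ⟨⟨⟨hσ, -⟩, hx⟩, hgx⟩, hmax⟩ :=
    hS.exists_isMaxOn ⟨_, hmemS hσ₀ hv hneg⟩ continuous_fst.continuousOn
  have hx1 : ‖x‖ = 1 := mem_sphere_zero_iff_norm.1 hx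
  have hpos_unit : ∀ z : E, ‖z‖ = 1 → 0 ≤ g (σ, z) := fun z hz => by
    have hlim : Filter.Tendsto (fun ν => g (ν, z)) (nhdsWithin σ (Set.Ioi σ)) (nhds (g (σ, z))) :=
      ((hg.comp (by fun_prop : Continuous fun ν : ℝ => (ν, z))).tendsto σ).mono_left
        nhdsWithin_le_nhds
    refine ge_of_tendsto hlim (Filter.eventually_of_mem self_mem_nhdsWithin fun ν hν => ?_)
    by_contra! hlt
    have hνσ : ν ≤ σ := hmax (hmemS (hσ.trans (Set.mem_Ioi.1 hν).le) hz hlt.le)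
    exact hνσ.not_gt hν
  have hpos : (growthOp p q H η σ).IsPositive := by
    refine ContinuousLinearMap.isPositive_def.2 ⟨hs.isSymmetric_growthOp hH η σ, fun z => ?_⟩
    rw [ContinuousLinearMap.reApplyInnerSelf_apply, real_inner_comm, RCLike.re_to_real]
    rcases eq_or_ne z 0 with rfl | hz
    · simp
    have hunit := hpos_unit (‖z‖⁻¹ • z) (norm_smul_inv_norm hz)
    simp only [g, map_smul, real_inner_smul_left, real_inner_smul_right] at hunit
    have hinv : 0 < ‖z‖⁻¹ := by positivity
    exact nonneg_of_mul_nonneg_right (nonneg_of_mul_nonneg_right hunit hinv) hinv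
  exact ⟨σ, hmax (hmemS hσ₀ hv hneg), hσ, hpos, x, norm_ne_zero_iff.1 (hx1 ▸ one_ne_zero),
    apply_eq_zero_of_isPositive hpos hgx⟩

namespace IsBlockSplit

theorem altStep_blockScale (hs : IsBlockSplit p q) (H : E →L[ℝ] E) {η σ : ℝ} (hη : η ≠ 0)
    (hσ : σ ≠ 0) (z : E) :
    altStep p q H η (blockScale p q σ z) =
      σ ^ 2 • blockScale p q σ (altStep p q (growthOp p q H η σ) (η / σ ^ 2) z) := by
  simp only [blockScale_apply, altStep_apply, growthOp_apply, map_add, map_sub, map_smul,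
    hs.left_left, hs.left_right, hs.right_left, hs.right_right, map_zero, smul_zero, add_zero,
    zero_add, smul_add, smul_sub, smul_smul]
  match_scalars <;> field_simp <;> ring

theorem altStep_pow_blockScale (hs : IsBlockSplit p q) (H : E →L[ℝ] E) {η σ : ℝ} (hη : η ≠ 0)
    (hσ : σ ≠ 0) (n : ℕ) (z : E) :
    (altStep p q H η ^ n) (blockScale p q σ z) =
      (σ ^ 2) ^ n • blockScale p q σ ((altStep p q (growthOp p q H η σ) (η / σ ^ 2) ^ n) z) := by
  induction n with
  | zero => simp
  | succ n ih =>
    rw [pow_succ', pow_succ' (altStep p q (growthOp p q H η σ) (η / σ ^ 2)), mul_apply_eq_comp, ih,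
      map_smul, hs.altStep_blockScale H hη hσ, smul_smul, ← pow_succ, mul_apply_eq_comp]

theorem blockScale_blockScale_inv (hs : IsBlockSplit p q) {σ : ℝ} (hσ : σ ≠ 0) (z : E) :
    blockScale p q σ (blockScale p q σ⁻¹ z) = z := by
  simp only [blockScale_apply, map_add, map_smul, hs.left_left, hs.left_right, hs.right_left,
    hs.right_right, smul_zero, add_zero, zero_add, smul_smul, inv_mul_cancel₀ hσ, one_smul,
    hs.apply_add_apply]

theorem norm_blockScale_le (hs : IsBlockSplit p q) {σ M : ℝ} (hσ : |σ| ≤ M) (hM : 1 ≤ M) (z : E) :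
    ‖blockScale p q σ z‖ ≤ M * ‖z‖ := by
  refine (sq_le_sq₀ (norm_nonneg _) (by positivity)).1 ?_
  rw [blockScale_apply, ← map_smul, hs.sq_norm_add, map_smul, norm_smul, mul_pow, mul_pow,
    hs.sq_norm_eq z, mul_add, Real.norm_eq_abs]
  gcongr
  exact le_mul_of_one_le_left (sq_nonneg _) (one_le_pow₀ hM)

theorem norm_altStep_pow_le_of_isPositive (hs : IsBlockSplit p q) (hG : G.IsPositive) {τ M : ℝ}
    (hτ : 0 ≤ τ) (hM : ∀ x, ⟪x, G x⟫ ≤ M * ‖x‖ ^ 2) (hτM : τ * M ≤ 1) (n : ℕ) (z : E) :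
    ‖(altStep p q G τ ^ n) z‖ ≤ (1 + √(2 * n * (τ * M))) * ‖z‖ := by
  have hstep : ∀ x, τ * ⟪x, G x⟫ ≤ ‖x‖ ^ 2 := fun x => by
    nlinarith [mul_le_mul_of_nonneg_left (hM x) hτ, sq_nonneg ‖x‖]
  have hdrift := sq_norm_sub_le_of_forall_sq_norm_sub_le
    (z := fun n => (altStep p q G τ ^ n) z) (φ := fun n =>
      ⟪(altStep p q G τ ^ n) z, G ((altStep p q G τ ^ n) z)⟫)
    (fun n => by
      simpa only [pow_succ', mul_apply_eq_comp] using hs.sq_norm_altStep_sub_le hG.isSymmetric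
        hstep ((altStep p q G τ ^ n) z)) n
  simp only [pow_zero, one_apply_eq_self] at hdrift
  have hsq : ‖(altStep p q G τ ^ n) z - z‖ ^ 2 ≤ 2 * n * (τ * M) * ‖z‖ ^ 2 := by
    refine hdrift.trans ?_
    calc n * (2 * τ * (⟪z, G z⟫ - ⟪(altStep p q G τ ^ n) z, G ((altStep p q G τ ^ n) z)⟫))
        ≤ n * (2 * τ * (M * ‖z‖ ^ 2)) := by
          gcongr
          linarith [hM z, hG.inner_nonneg_right ((altStep p q G τ ^ n) z)]
      _ = 2 * n * (τ * M) * ‖z‖ ^ 2 := by ring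
  have hdist : ‖(altStep p q G τ ^ n) z - z‖ ≤ √(2 * n * (τ * M)) * ‖z‖ := by
    rw [← Real.sqrt_sq (norm_nonneg z), ← Real.sqrt_mul' _ (sq_nonneg _)]
    exact Real.le_sqrt_of_sq_le hsq
  linarith [norm_le_norm_add_norm_sub' ((altStep p q G τ ^ n) z) z]

end IsBlockSplit

namespace IsGrowthRoot

variable {η σ : ℝ}

theorem sq_sub_one_div_le (h : IsGrowthRoot p q H η σ) (hs : IsBlockSplit p q) :
    (σ ^ 2 - 1) / η ≤ (2 * σ - 1) * ‖H‖ := by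
  obtain ⟨x, hx, hker⟩ := h.exists_ker
  exact hs.sq_sub_one_div_le_of_inner_growthOp_nonpos h.one_le hx (by simp [hker])

theorem le_three_halves (h : IsGrowthRoot p q H η σ) (hs : IsBlockSplit p q) (hη : 0 < η)
    (hηH : η * ‖H‖ ≤ 1 / 4) : σ ≤ 3 / 2 := by
  obtain ⟨x, hx, hker⟩ := h.exists_ker
  linarith [hs.le_of_inner_growthOp_nonpos (H := H) hη h.one_le hx (by simp [hker])]

theorem norm_altStep_pow_le (h : IsGrowthRoot p q H η σ) (hs : IsBlockSplit p q) (hη : 0 < η)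
    (hηH : η * ‖H‖ ≤ 1 / 4) (n : ℕ) (v : E) :
    ‖(altStep p q H η ^ n) v‖ ≤ 2 * (1 + √(8 * n * (η * ‖H‖))) * (σ ^ 2) ^ n * ‖v‖ := by
  have hσ := h.one_le
  have hσ' := h.le_three_halves hs hη hηH
  have hσ0 : 0 < σ := by linarith
  have hτ : η / σ ^ 2 * (4 * ‖H‖) ≤ 4 * (η * ‖H‖) := by
    rw [← mul_assoc, mul_comm (η / σ ^ 2), mul_assoc]
    gcongr
    exact div_le_self hη.le (one_le_pow₀ hσ)
  have hupper : ∀ x, ⟪x, growthOp p q H η σ x⟫ ≤ 4 * ‖H‖ * ‖x‖ ^ 2 := fun x => by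
    have hshift := mul_le_mul_of_nonneg_right (h.sq_sub_one_div_le hs) (sq_nonneg ‖x‖)
    have hbound := le_of_abs_le (hs.abs_inner_growthOp_self_sub_le (H := H) hσ η x)
    nlinarith [mul_nonneg (norm_nonneg H) (sq_nonneg ‖x‖)]
  have hrescaled := hs.norm_altStep_pow_le_of_isPositive h.isPositive (τ := η / σ ^ 2)
    (by positivity) hupper (by linarith) n (blockScale p q σ⁻¹ v)
  have hinv : ‖blockScale p q σ⁻¹ v‖ ≤ ‖v‖ := by
    simpa using hs.norm_blockScale_le (M := 1)
      (by rw [abs_inv, abs_of_pos hσ0]; exact inv_le_one_of_one_le₀ hσ) le_rfl v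
  calc ‖(altStep p q H η ^ n) v‖
      = (σ ^ 2) ^ n * ‖blockScale p q σ ((altStep p q (growthOp p q H η σ) (η / σ ^ 2) ^ n)
          (blockScale p q σ⁻¹ v))‖ := by
        rw [← hs.blockScale_blockScale_inv hσ0.ne' v,
          hs.altStep_pow_blockScale H hη.ne' hσ0.ne', norm_smul,
          Real.norm_of_nonneg (by positivity), hs.blockScale_blockScale_inv hσ0.ne']
    _ ≤ (σ ^ 2) ^ n * (2 * ((1 + √(2 * n * (4 * (η * ‖H‖)))) * ‖v‖)) := by
        gcongr
        refine (hs.norm_blockScale_le (by rw [abs_of_pos hσ0]; linarith) one_le_two _).trans ?_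
        gcongr
        exact hrescaled.trans (by rw [mul_assoc 2 (n : ℝ), mul_assoc 2 (n : ℝ)]; gcongr)
    _ = 2 * (1 + √(8 * n * (η * ‖H‖))) * (σ ^ 2) ^ n * ‖v‖ := by
        rw [show 2 * (n : ℝ) * (4 * (η * ‖H‖)) = 8 * n * (η * ‖H‖) by ring]; ring

end IsGrowthRoot

namespace IsBlockSplit

theorem inner_altStep_of_growthOp_eq_zero (hs : IsBlockSplit p q) (hH : H.IsSymmetric) {η σ : ℝ}
    (hη : η ≠ 0) {x : E} (hx : growthOp p q H η σ x = 0) (v : E) :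
    ⟪(σ / η) • (σ • p x + q x) + σ • p (H (q x)), altStep p q H η v⟫ =
      σ ^ 2 * ⟪(σ / η) • (σ • p x + q x) + σ • p (H (q x)), v⟫ := by
  obtain ⟨a, b, rfl⟩ : ∃ a b, v = p a + q b := ⟨v, v, (hs.apply_add_apply v).symm⟩
  have hp : ⟪p (growthOp p q H η σ x), p a + q b⟫ = 0 := by rw [hx, map_zero, inner_zero_left]
  have hq : ⟪q (growthOp p q H η σ x), p a + q b⟫ = 0 := by rw [hx, map_zero, inner_zero_left]
  simp only [growthOp_apply, altStep_apply, inner_add_left, inner_add_right, inner_sub_right,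
    real_inner_smul_left, real_inner_smul_right, map_add, map_sub, map_smul, hs.inner_left,
    hs.inner_right, hH.apply_clm, hs.left_left, hs.left_right, hs.right_left, hs.right_right,
    inner_zero_right, map_zero, sub_zero, add_zero, zero_add, mul_zero] at hp hq ⊢
  linear_combination (norm := (field_simp; ring)) -σ ^ 2 * hp - σ * hq

theorem eq_zero_of_left_eigenvector_eq_zero (hs : IsBlockSplit p q) {η σ : ℝ} (hη : η ≠ 0)
    (hσ : σ ≠ 0) {x : E} (hx : (σ / η) • (σ • p x + q x) + σ • p (H (q x)) = 0) : x = 0 := by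
  have hq : q x = 0 := by
    have hqx := congrArg q hx
    simp only [map_add, map_smul, hs.right_left, hs.right_right, smul_zero, zero_add, add_zero,
      map_zero] at hqx
    exact (smul_eq_zero.1 hqx).resolve_left (div_ne_zero hσ hη)
  simp only [hq, map_zero, smul_zero, add_zero, smul_smul] at hx
  have hp := (smul_eq_zero.1 hx).resolve_left (mul_ne_zero (div_ne_zero hσ hη) hσ)
  rw [← hs.apply_add_apply x, hp, hq, add_zero]

end IsBlockSplit

theorem IsGrowthRoot.exists_left_eigenvector {η σ : ℝ} (h : IsGrowthRoot p q H η σ)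
    (hs : IsBlockSplit p q) (hH : H.IsSymmetric) (hη : η ≠ 0) :
    ∃ φ : E, ‖φ‖ = 1 ∧ ∀ w, ⟪φ, altStep p q H η w⟫ = σ ^ 2 * ⟪φ, w⟫ := by
  obtain ⟨x, hx, hker⟩ := h.exists_ker
  set ψ := (σ / η) • (σ • p x + q x) + σ • p (H (q x)) with hψ
  have hψ0 : ψ ≠ 0 := fun h0 =>
    hx (hs.eq_zero_of_left_eigenvector_eq_zero hη (by linarith [h.one_le]) h0)
  refine ⟨‖ψ‖⁻¹ • ψ, norm_smul_inv_norm hψ0, fun w => ?_⟩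
  rw [real_inner_smul_left, real_inner_smul_left, hψ,
    hs.inner_altStep_of_growthOp_eq_zero hH hη hker]
  ring

theorem IsBlockSplit.exists_left_eigenvector [FiniteDimensional ℝ E] (hs : IsBlockSplit p q)
    (hH : H.IsSymmetric) {η γ : ℝ} (hη : 0 < η) (hηH : η * ‖H‖ ≤ 1 / 4) (hγ : 0 ≤ γ) {v : E}
    (hv : ‖v‖ = 1) (hvH : ⟪v, H v⟫ ≤ -γ) :
    ∃ l : ℝ, 1 + η * γ / 2 ≤ l ∧
      (∃ φ : E, ‖φ‖ = 1 ∧ ∀ w, ⟪φ, altStep p q H η w⟫ = l * ⟪φ, w⟫) ∧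
      ∀ (n : ℕ) (w : E),
        ‖(altStep p q H η ^ n) w‖ ≤ 2 * (1 + √(8 * n * (η * ‖H‖))) * l ^ n * ‖w‖ := by
  have hηγ := mul_nonneg hη.le hγ
  obtain ⟨σ, hσ, hroot⟩ := hs.exists_isGrowthRoot hH hη
    (Real.one_le_sqrt.2 (by linarith)) hv (hs.inner_growthOp_nonpos hη hγ hηH hv hvH)
  refine ⟨σ ^ 2, ?_, hroot.exists_left_eigenvector hs hH hη.ne',
    hroot.norm_altStep_pow_le hs hη hηH⟩
  rw [← Real.sq_sqrt (show 0 ≤ 1 + η * γ / 2 by linarith)]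
  gcongr

end QuadraticStep

/-! ### Smooth objectives and their block gradients -/

section Calculus

variable {E : Type*} [NormedAddCommGroup E] [InnerProductSpace ℝ E] [CompleteSpace E] {f : E → ℝ}

theorem hasDerivAt_comp_add_smul (hf : Differentiable ℝ f) (x v : E) (s : ℝ) :
    HasDerivAt (fun s : ℝ => f (x + s • v)) ⟪gradient f (x + s • v), v⟫ s := by
  have hline : HasDerivAt (fun s : ℝ => x + s • v) v s := by
    simpa using ((hasDerivAt_id s).smul_const v).const_add x
  exact (hf (x + s • v)).hasGradientAt.hasFDerivAt.comp_hasDerivAt s hline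

theorem apply_add_smul_le_of_inner_gradient_le (hf : Differentiable ℝ f) {x v : E} {B B' : ℝ → ℝ}
    (hB : ∀ s, HasDerivAt B (B' s) s) (hB0 : B 0 = 0) {b : ℝ} (hb : 0 ≤ b)
    (hle : ∀ s, 0 ≤ s → s ≤ b → ⟪gradient f (x + s • v), v⟫ ≤ B' s) :
    f (x + b • v) ≤ f x + B b := by
  have hderiv := hasDerivAt_comp_add_smul hf x v
  refine image_le_of_deriv_right_le_deriv_boundary (a := 0) (b := b)
    (f := fun s => f (x + s • v)) (B := fun s => f x + B s) (B' := B')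
    (fun s _ => (hderiv s).continuousAt.continuousWithinAt)
    (fun s _ => (hderiv s).hasDerivWithinAt) (by simp [hB0])
    (fun s _ => ((hB s).const_add _).continuousAt.continuousWithinAt)
    (fun s _ => ((hB s).const_add _).hasDerivWithinAt)
    (fun s hs => hle s hs.1 hs.2.le) (Set.right_mem_Icc.2 hb)

theorem apply_le_add_of_norm_sub_le (hf : Differentiable ℝ f) {Λ : ℝ} (hΛ : 0 ≤ Λ)
    (hlip : ∀ x y, ‖gradient f x - gradient f y‖ ≤ Λ * ‖x - y‖) {r : ℝ} {x y : E}
    (hy : ‖y - x‖ ≤ r) : f y ≤ f x + (‖gradient f x‖ + Λ * r) * r := by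
  have hr : 0 ≤ r := (norm_nonneg _).trans hy
  have hgrad : ∀ z ∈ Metric.closedBall x r,
      ‖InnerProductSpace.toDual ℝ E (gradient f z)‖ ≤ ‖gradient f x‖ + Λ * r := fun z hz => by
    rw [mem_closedBall_iff_norm] at hz
    rw [LinearIsometryEquiv.norm_map]
    exact (norm_le_norm_add_norm_sub' _ (gradient f x)).trans
      (by gcongr; exact (hlip z x).trans (by gcongr))
  have hmean := (convex_closedBall x r).norm_image_sub_le_of_norm_hasFDerivWithin_le
    (fun z _ => (hf z).hasGradientAt.hasFDerivAt.hasFDerivWithinAt) hgrad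
    (Metric.mem_closedBall_self hr) (mem_closedBall_iff_norm.2 hy)
  calc f y ≤ f x + ‖f y - f x‖ := by linarith [Real.le_norm_self (f y - f x)]
    _ ≤ f x + (‖gradient f x‖ + Λ * r) * r := by gcongr; exact hmean.trans (by gcongr)

theorem isSymmetric_fderiv_gradient (hf : Differentiable ℝ f) {x : E}
    (hx : DifferentiableAt ℝ (gradient f) x) : (fderiv ℝ (gradient f) x).IsSymmetric := by
  have hdual : HasFDerivAt (fun y => InnerProductSpace.toDual ℝ E (gradient f y))
      ((InnerProductSpace.toDual ℝ E).toContinuousLinearEquiv.toContinuousLinearMap.comp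
        (fderiv ℝ (gradient f) x)) x :=
    (InnerProductSpace.toDual ℝ E).toContinuousLinearEquiv.hasFDerivAt.comp x hx.hasFDerivAt
  intro v w
  rw [real_inner_comm _ v]
  exact second_derivative_symmetric (fun y => (hf y).hasGradientAt.hasFDerivAt) hdual v w

end Calculus

theorem norm_image_sub_sub_fderiv_le {E F : Type*} [NormedAddCommGroup E] [NormedSpace ℝ E]
    [NormedAddCommGroup F] [NormedSpace ℝ F] {g : E → F} (hg : Differentiable ℝ g) {ρ S : ℝ}
    (hρ : 0 ≤ ρ) {x u w : E} (hlip : ∀ y, ‖fderiv ℝ g y - fderiv ℝ g x‖ ≤ ρ * ‖y - x‖)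
    (hu : ‖u - x‖ ≤ S) (hw : ‖w - x‖ ≤ S) :
    ‖g w - g u - fderiv ℝ g x (w - u)‖ ≤ ρ * S * ‖w - u‖ :=
  (convex_closedBall x S).norm_image_sub_le_of_norm_hasFDerivWithin_le'
    (fun y _ => (hg y).hasFDerivAt.hasFDerivWithinAt)
    (fun y hy => (hlip y).trans (by rw [mem_closedBall_iff_norm] at hy; gcongr))
    (mem_closedBall_iff_norm.2 hu) (mem_closedBall_iff_norm.2 hw)

section Blocks

variable {d : ℕ} {blk : Fin d → Fin 2} {f : EuclideanSpace ℝ (Fin d) → ℝ} {Lb Lt : Fin 2 → ℝ}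

/-- `blockPart` as a continuous linear map: the orthogonal projection onto the `k`-th block. -/
noncomputable def blockProj (blk : Fin d → Fin 2) (k : Fin 2) :
    EuclideanSpace ℝ (Fin d) →L[ℝ] EuclideanSpace ℝ (Fin d) :=
  LinearMap.toContinuousLinearMap
    { toFun := blockPart blk k
      map_add' := fun x y => by
        ext i; simp only [blockPart, PiLp.add_apply]; split_ifs <;> simp
      map_smul' := fun a x => by
        ext i; simp only [blockPart, PiLp.smul_apply, RingHom.id_apply]; split_ifs <;> simp }

theorem blockProj_apply (k : Fin 2) (x : EuclideanSpace ℝ (Fin d)) (i : Fin d) :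
    blockProj blk k x i = if blk i = k then x i else 0 := rfl

theorem blockGrad_eq (k : Fin 2) (x : EuclideanSpace ℝ (Fin d)) :
    blockGrad blk f k x = blockProj blk k (gradient f x) := rfl

theorem isBlockSplit_blockProj (blk : Fin d → Fin 2) {j k : Fin 2} (hjk : j ≠ k) :
    IsBlockSplit (blockProj blk j) (blockProj blk k) where
  isSymmetricProjection := by
    refine ⟨?_, fun x y => ?_⟩
    · ext x i
      change blockProj blk j (blockProj blk j x) i = blockProj blk j x i
      simp only [blockProj_apply]
      split_ifs <;> rfl
    · simp only [ContinuousLinearMap.coe_coe, PiLp.inner_apply, blockProj_apply]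
      refine Finset.sum_congr rfl fun i _ => ?_
      split_ifs <;> simp
  add_eq_one := by
    ext x i
    have hblk : blk i = j ∨ blk i = k := by omega
    rcases hblk with h | h <;> simp [blockProj_apply, h, hjk, hjk.symm]

theorem norm_blockProj_le (k : Fin 2) (x : EuclideanSpace ℝ (Fin d)) :
    ‖blockProj blk k x‖ ≤ ‖x‖ :=
  let ⟨_, hj⟩ := exists_ne k
  (isBlockSplit_blockProj blk hj.symm).norm_left_le x

theorem norm_sub_blockProj_le (k : Fin 2) (x : EuclideanSpace ℝ (Fin d)) :
    ‖x - blockProj blk k x‖ ≤ ‖x‖ := by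
  obtain ⟨j, hj⟩ := exists_ne k
  rw [sub_eq_of_eq_add ((isBlockSplit_blockProj blk hj).apply_add_apply x).symm]
  exact norm_blockProj_le j x

theorem block_le_blockLmax (Lb Lt : Fin 2 → ℝ) (k : Fin 2) : Lb k ≤ blockLmax Lb Lt := by
  fin_cases k <;> simp [blockLmax]

theorem cross_le_blockLmax (Lb Lt : Fin 2 → ℝ) (k : Fin 2) : Lt k ≤ blockLmax Lb Lt := by
  fin_cases k <;> simp [blockLmax]

theorem agdStep_sub (η : ℝ) (x : EuclideanSpace ℝ (Fin d)) :
    agdStep blk f η x - x = -(η • (blockProj blk 0 (gradient f x) +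
      blockProj blk 1 (gradient f (agdHalf blk f η x)))) := by
  have hhalf : agdHalf blk f η x = x - η • blockProj blk 0 (gradient f x) := rfl
  rw [agdStep, blockGrad_eq, smul_add]
  nth_rewrite 1 [hhalf]
  abel

theorem sq_norm_agdStep_sub (η : ℝ) (x : EuclideanSpace ℝ (Fin d)) :
    ‖agdStep blk f η x - x‖ ^ 2 = η ^ 2 * agdGradSq blk f η x := by
  rw [agdStep_sub, norm_neg, norm_smul, mul_pow,
    (isBlockSplit_blockProj blk zero_ne_one).sq_norm_add, Real.norm_eq_abs, sq_abs]
  rfl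

theorem norm_agdHalf_sub_le (η : ℝ) (x : EuclideanSpace ℝ (Fin d)) :
    ‖agdHalf blk f η x - x‖ ≤ ‖agdStep blk f η x - x‖ := by
  rw [← sq_le_sq₀ (norm_nonneg _) (norm_nonneg _), sq_norm_agdStep_sub, agdHalf,
    sub_sub_cancel_left, norm_neg, norm_smul, mul_pow, Real.norm_eq_abs, sq_abs, agdGradSq]
  gcongr
  exact le_add_of_nonneg_right (sq_nonneg _)

namespace IsBlockSmooth

theorem norm_blockGrad_sub_le_of_same_block (h : IsBlockSmooth blk f Lb Lt) {k : Fin 2}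
    {x y : EuclideanSpace ℝ (Fin d)} (hxy : ∀ i, blk i ≠ k → x i = y i) :
    ‖blockGrad blk f k x - blockGrad blk f k y‖ ≤ blockLmax Lb Lt * ‖x - y‖ :=
  (h.2.1 k x y hxy).trans (by gcongr; exact block_le_blockLmax Lb Lt k)

theorem norm_blockGrad_sub_le_of_other_block (h : IsBlockSmooth blk f Lb Lt) {k : Fin 2}
    {x y : EuclideanSpace ℝ (Fin d)} (hxy : ∀ i, blk i = k → x i = y i) :
    ‖blockGrad blk f k x - blockGrad blk f k y‖ ≤ blockLmax Lb Lt * ‖x - y‖ :=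
  (h.2.2 k x y hxy).trans (by gcongr; exact cross_le_blockLmax Lb Lt k)

theorem norm_blockGrad_sub_le (h : IsBlockSmooth blk f Lb Lt) (hM : 0 ≤ blockLmax Lb Lt)
    (k : Fin 2) (x y : EuclideanSpace ℝ (Fin d)) :
    ‖blockGrad blk f k x - blockGrad blk f k y‖ ≤ 2 * blockLmax Lb Lt * ‖x - y‖ := by
  set m := x - blockProj blk k (x - y) with hm
  have hxm : ‖blockGrad blk f k x - blockGrad blk f k m‖ ≤ blockLmax Lb Lt * ‖x - y‖ := by
    refine (h.norm_blockGrad_sub_le_of_same_block fun i hi => ?_).trans ?_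
    · simp [hm, blockProj_apply, hi]
    · rw [hm, sub_sub_cancel]
      gcongr
      exact norm_blockProj_le k _
  have hmy : ‖blockGrad blk f k m - blockGrad blk f k y‖ ≤ blockLmax Lb Lt * ‖x - y‖ := by
    refine (h.norm_blockGrad_sub_le_of_other_block fun i hi => ?_).trans ?_
    · simp [hm, blockProj_apply, hi]
    · rw [hm, sub_right_comm]
      gcongr
      exact norm_sub_blockProj_le k _
  linarith [norm_sub_le_norm_sub_add_norm_sub (blockGrad blk f k x) (blockGrad blk f k m)
    (blockGrad blk f k y)]

theorem norm_gradient_sub_le (h : IsBlockSmooth blk f Lb Lt) (hM : 0 ≤ blockLmax Lb Lt)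
    (x y : EuclideanSpace ℝ (Fin d)) :
    ‖gradient f x - gradient f y‖ ≤ 4 * blockLmax Lb Lt * ‖x - y‖ :=
  calc ‖gradient f x - gradient f y‖
      = ‖(blockGrad blk f 0 x - blockGrad blk f 0 y) +
          (blockGrad blk f 1 x - blockGrad blk f 1 y)‖ := by
        simp only [blockGrad_eq, ← map_sub,
          (isBlockSplit_blockProj blk zero_ne_one).apply_add_apply]
    _ ≤ 2 * blockLmax Lb Lt * ‖x - y‖ + 2 * blockLmax Lb Lt * ‖x - y‖ :=
        norm_add_le_of_le (h.norm_blockGrad_sub_le hM 0 x y) (h.norm_blockGrad_sub_le hM 1 x y)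
    _ = 4 * blockLmax Lb Lt * ‖x - y‖ := by ring

theorem norm_hessian_le (h : IsBlockSmooth blk f Lb Lt) (hM : 0 ≤ blockLmax Lb Lt)
    (x : EuclideanSpace ℝ (Fin d)) : ‖hessian f x‖ ≤ 4 * blockLmax Lb Lt :=
  norm_fderiv_le_of_lip' ℝ (by positivity)
    (Filter.Eventually.of_forall fun y => h.norm_gradient_sub_le hM y x)

theorem block_step_le (h : IsBlockSmooth blk f Lb Lt) {η : ℝ} (hη : 0 ≤ η)
    (hηL : η * blockLmax Lb Lt ≤ 1 / 2) (k : Fin 2) (x : EuclideanSpace ℝ (Fin d)) :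
    f (x - η • blockGrad blk f k x) ≤ f x - η / 2 * ‖blockGrad blk f k x‖ ^ 2 := by
  set g := blockGrad blk f k x with hg
  have hslope : ∀ s, 0 ≤ s → s ≤ η → ⟪gradient f (x + s • -g), -g⟫ ≤ -(‖g‖ ^ 2 / 2) := by
    intro s hs hsη
    obtain ⟨j, hj⟩ := exists_ne k
    set y := x + s • -g with hy
    have hblock : ⟪gradient f y, g⟫ = ‖g‖ ^ 2 + ⟪blockGrad blk f k y - g, g⟫ := by
      rw [inner_sub_left, real_inner_self_eq_norm_sq, add_sub_cancel, hg, blockGrad_eq,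
        blockGrad_eq, (isBlockSplit_blockProj blk hj.symm).inner_left_left]
    have hdist : ‖y - x‖ = s * ‖g‖ := by
      rw [hy, add_sub_cancel_left, norm_smul, norm_neg, Real.norm_of_nonneg hs]
    have hdiff : ‖blockGrad blk f k y - g‖ ≤ blockLmax Lb Lt * (s * ‖g‖) := by
      rw [← hdist]
      refine h.norm_blockGrad_sub_le_of_same_block fun i hi => ?_
      rw [hy, hg, blockGrad_eq]
      simp [blockProj_apply, hi]
    have hsmall : blockLmax Lb Lt * s ≤ 1 / 2 := by
      rcases le_total 0 (blockLmax Lb Lt) with hM | hM <;> nlinarith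
    rw [inner_neg_right, hblock]
    have hcs := neg_le_of_abs_le (abs_real_inner_le_norm (blockGrad blk f k y - g) g)
    nlinarith [mul_le_mul_of_nonneg_right hdiff (norm_nonneg g),
      mul_le_mul_of_nonneg_right hsmall (sq_nonneg ‖g‖)]
  have hdecrease := apply_add_smul_le_of_inner_gradient_le h.1
    (fun s => (hasDerivAt_id s).mul_const (-(‖g‖ ^ 2 / 2))) (zero_mul _) hη
    (by simpa only [one_mul] using hslope)
  rw [smul_neg, ← sub_eq_add_neg] at hdecrease
  simp only [id_eq] at hdecrease
  linarith

theorem agdStep_le (h : IsBlockSmooth blk f Lb Lt) {η : ℝ} (hη : 0 ≤ η)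
    (hηL : η * blockLmax Lb Lt ≤ 1 / 2) (x : EuclideanSpace ℝ (Fin d)) :
    f (agdStep blk f η x) ≤ f x - η / 2 * agdGradSq blk f η x := by
  have hfirst := h.block_step_le hη hηL 0 x
  have hsecond := h.block_step_le hη hηL 1 (agdHalf blk f η x)
  rw [← agdHalf] at hfirst
  rw [agdGradSq, agdStep, mul_add]
  linarith

theorem norm_gradient_le (h : IsBlockSmooth blk f Lb Lt) {η : ℝ} (hη : 0 ≤ η)
    (hηL : η * blockLmax Lb Lt ≤ 1 / 2) {g : ℝ} (hg : 0 ≤ g) {x : EuclideanSpace ℝ (Fin d)}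
    (hx : agdGradSq blk f η x ≤ g ^ 2) : ‖gradient f x‖ ≤ 2 * g := by
  set a := ‖blockGrad blk f 0 x‖
  set b := ‖blockGrad blk f 1 (agdHalf blk f η x)‖
  have hhalf : ‖blockGrad blk f 1 (agdHalf blk f η x) - blockGrad blk f 1 x‖ ≤ 1 / 2 * a := by
    refine (h.norm_blockGrad_sub_le_of_other_block fun i hi => ?_).trans ?_
    · rw [agdHalf, blockGrad_eq]; simp [blockProj_apply, hi]
    · rw [agdHalf, sub_sub_cancel_left, norm_neg, norm_smul, Real.norm_of_nonneg hη, ← mul_assoc,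
        mul_comm (blockLmax Lb Lt)]
      gcongr
  have hsecond : ‖blockGrad blk f 1 x‖ ≤ b + 1 / 2 * a := by
    linarith [norm_le_norm_add_norm_sub (blockGrad blk f 1 (agdHalf blk f η x))
      (blockGrad blk f 1 x)]
  have hab : a ^ 2 + b ^ 2 ≤ g ^ 2 := hx
  refine (sq_le_sq₀ (norm_nonneg _) (by positivity)).1 ?_
  calc ‖gradient f x‖ ^ 2 = a ^ 2 + ‖blockGrad blk f 1 x‖ ^ 2 :=
        (isBlockSplit_blockProj blk zero_ne_one).sq_norm_eq _
    _ ≤ a ^ 2 + (b + 1 / 2 * a) ^ 2 := by gcongr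
    _ ≤ (2 * g) ^ 2 := by nlinarith [sq_nonneg (a - b)]

end IsBlockSmooth

namespace IsHessianLipschitz

variable {ρ : ℝ}

theorem isSymmetric_hessian (h : IsHessianLipschitz f ρ) (x : EuclideanSpace ℝ (Fin d)) :
    (hessian f x).IsSymmetric :=
  isSymmetric_fderiv_gradient h.1 (h.2.1 x)

theorem norm_gradient_sub_sub_le (h : IsHessianLipschitz f ρ) (hρ : 0 ≤ ρ) {S : ℝ}
    {x u w : EuclideanSpace ℝ (Fin d)} (hu : ‖u - x‖ ≤ S) (hw : ‖w - x‖ ≤ S) :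
    ‖gradient f w - gradient f u - hessian f x (w - u)‖ ≤ ρ * S * ‖w - u‖ :=
  norm_image_sub_sub_fderiv_le h.2.1 hρ (fun y => h.2.2 y x) hu hw

theorem exists_le_sub_of_curvature_le (h : IsHessianLipschitz f ρ) (hρ : 0 < ρ) {γ : ℝ}
    (hγ : 0 ≤ γ) {x v : EuclideanSpace ℝ (Fin d)} (hv : ‖v‖ = 1)
    (hvH : ⟪v, hessian f x v⟫ ≤ -γ) : ∃ y, f y ≤ f x - γ ^ 3 / (16 * ρ ^ 2) := by
  wlog hdescent : ⟪gradient f x, v⟫ ≤ 0 generalizing v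
  · exact this (v := -v) (by rwa [norm_neg]) (by simpa using hvH) (by
      rw [inner_neg_right]; linarith)
  have hslope : ∀ s, 0 ≤ s → s ≤ γ / (2 * ρ) →
      ⟪gradient f (x + s • v), v⟫ ≤ -γ / 4 * (2 * s) := by
    intro s hs hsγ
    have htaylor : ‖gradient f (x + s • v) - gradient f x - s • hessian f x v‖ ≤ ρ * s * s := by
      simpa [norm_smul, hv, abs_of_nonneg hs] using
        h.norm_gradient_sub_sub_le hρ.le (S := s) (x := x) (u := x) (w := x + s • v)
          (by simpa using hs) (by simp [norm_smul, hv, abs_of_nonneg hs])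
    have hρs : ρ * s ≤ γ / 2 :=
      (mul_le_mul_of_nonneg_left hsγ hρ.le).trans_eq (by field_simp)
    have hcs := real_inner_le_norm (gradient f (x + s • v) - gradient f x - s • hessian f x v) v
    rw [hv, mul_one, inner_sub_left, inner_sub_left, real_inner_smul_left,
      real_inner_comm v (hessian f x v)] at hcs
    nlinarith
  have hdecrease := apply_add_smul_le_of_inner_gradient_le h.1
    (fun s => by simpa using (hasDerivAt_pow 2 s).const_mul (-γ / 4)) (by simp)
    (by positivity) hslope
  refine ⟨_, hdecrease.trans_eq ?_⟩
  field_simp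
  ring

end IsHessianLipschitz

theorem exists_unit_of_not_isSS2 {ε γ : ℝ} {x : EuclideanSpace ℝ (Fin d)}
    (hx : ‖gradient f x‖ ≤ ε) (h : ¬ IsSS2 f ε γ x) :
    ∃ v, ‖v‖ = 1 ∧ ⟪v, hessian f x v⟫ ≤ -γ := by
  obtain ⟨μ, hμ, hμγ⟩ : ∃ μ, Module.End.HasEigenvalue (hessian f x).toLinearMap μ ∧ μ < -γ := by
    simpa [IsSS2, hx] using h
  obtain ⟨w, hw⟩ := hμ.exists_hasEigenvector
  have hunit : ‖‖w‖⁻¹ • w‖ = 1 := norm_smul_inv_norm hw.2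
  have heigen : hessian f x w = μ • w := hw.apply_eq_smul
  refine ⟨‖w‖⁻¹ • w, hunit, ?_⟩
  rw [map_smul, heigen, smul_comm, real_inner_smul_right, real_inner_self_eq_norm_sq, hunit]
  linarith

end Blocks

/-! ### Stuck trajectories -/

section Trajectories

variable {d : ℕ} {blk : Fin d → Fin 2} {f : EuclideanSpace ℝ (Fin d) → ℝ} {Lb Lt : Fin 2 → ℝ}
  {ρ η g : ℝ}

theorem agdHalf_sub_agdHalf (u w : EuclideanSpace ℝ (Fin d)) :
    agdHalf blk f η w - agdHalf blk f η u =
      (w - u) - η • blockProj blk 0 (gradient f w - gradient f u) := by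
  rw [agdHalf, agdHalf, blockGrad_eq, blockGrad_eq, map_sub, smul_sub]
  abel

theorem norm_agdHalf_sub_agdHalf_le (hη : 0 ≤ η) {Λ : ℝ} {u w : EuclideanSpace ℝ (Fin d)}
    (hlip : ‖gradient f w - gradient f u‖ ≤ Λ * ‖w - u‖) :
    ‖agdHalf blk f η w - agdHalf blk f η u‖ ≤ (1 + η * Λ) * ‖w - u‖ := by
  rw [agdHalf_sub_agdHalf, add_mul, one_mul, mul_assoc]
  refine norm_sub_le_of_le le_rfl ?_
  rw [norm_smul, Real.norm_of_nonneg hη]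
  gcongr
  exact (norm_blockProj_le 0 _).trans hlip

theorem agdStep_sub_agdStep_sub_altStep
    {H : EuclideanSpace ℝ (Fin d) →L[ℝ] EuclideanSpace ℝ (Fin d)}
    {u w e₁ e₂ : EuclideanSpace ℝ (Fin d)}
    (h₁ : gradient f w - gradient f u = H (w - u) + e₁)
    (h₂ : gradient f (agdHalf blk f η w) - gradient f (agdHalf blk f η u) =
      H (agdHalf blk f η w - agdHalf blk f η u) + e₂) :
    agdStep blk f η w - agdStep blk f η u -
        altStep (blockProj blk 0) (blockProj blk 1) H η (w - u) =
      η • blockProj blk 1 (H (η • blockProj blk 0 e₁)) - η • blockProj blk 0 e₁ -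
        η • blockProj blk 1 e₂ := by
  set p := blockProj blk 0
  set q := blockProj blk 1
  have hhalf := agdHalf_sub_agdHalf (blk := blk) (f := f) (η := η) u w
  set v := agdHalf blk f η w - agdHalf blk f η u with hv
  have hstep : agdStep blk f η w - agdStep blk f η u = v - η • q (H v + e₂) := by
    rw [← h₂, hv, agdStep, agdStep, blockGrad_eq, blockGrad_eq, map_sub, smul_sub]
    abel
  have hlin : (w - u) - η • p (H (w - u)) = v + η • p e₁ := by
    rw [hhalf, h₁, map_add, smul_add]
    abel
  rw [hstep, altStep_apply, hlin]
  simp only [map_add, smul_add]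
  abel

theorem IsBlockSmooth.norm_agdStep_sub_altStep_le (h : IsBlockSmooth blk f Lb Lt)
    (hM : 0 ≤ blockLmax Lb Lt) (hH : IsHessianLipschitz f ρ) (hρ : 0 ≤ ρ) (hη : 0 ≤ η)
    (hηL : η * blockLmax Lb Lt ≤ 1 / 16) {S : ℝ} {x u w : EuclideanSpace ℝ (Fin d)}
    (hu : ‖u - x‖ ≤ S) (hw : ‖w - x‖ ≤ S) (hu' : ‖agdHalf blk f η u - x‖ ≤ S)
    (hw' : ‖agdHalf blk f η w - x‖ ≤ S) :
    ‖agdStep blk f η w - agdStep blk f η u -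
      altStep (blockProj blk 0) (blockProj blk 1) (hessian f x) η (w - u)‖ ≤
      4 * η * ρ * S * ‖w - u‖ := by
  have hS : 0 ≤ S := (norm_nonneg _).trans hu
  have he₁ := hH.norm_gradient_sub_sub_le hρ hu hw
  have he₂ := hH.norm_gradient_sub_sub_le hρ hu' hw'
  have hηΛ : η * (4 * blockLmax Lb Lt) ≤ 1 / 4 := by linarith
  have hhalf := norm_agdHalf_sub_agdHalf_le (blk := blk) hη (h.norm_gradient_sub_le hM w u)
  rw [agdStep_sub_agdStep_sub_altStep (add_sub_cancel _ _).symm (add_sub_cancel _ _).symm]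
  set e₁ := gradient f w - gradient f u - hessian f x (w - u)
  set e₂ := gradient f (agdHalf blk f η w) - gradient f (agdHalf blk f η u) -
    hessian f x (agdHalf blk f η w - agdHalf blk f η u)
  have hproj : ∀ k e, ‖η • blockProj blk k e‖ ≤ η * ‖e‖ := fun k e => by
    rw [norm_smul, Real.norm_of_nonneg hη]
    gcongr
    exact norm_blockProj_le k e
  have hcross : ‖η • blockProj blk 1 (hessian f x (η • blockProj blk 0 e₁))‖ ≤
      1 / 4 * (η * ‖e₁‖) :=
    calc _ ≤ η * ‖hessian f x (η • blockProj blk 0 e₁)‖ := hproj 1 _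
      _ ≤ η * (4 * blockLmax Lb Lt * (η * ‖e₁‖)) := by
        gcongr
        exact (hessian f x).le_of_opNorm_le_of_le (h.norm_hessian_le hM x) (hproj 0 e₁)
      _ = η * (4 * blockLmax Lb Lt) * (η * ‖e₁‖) := by ring
      _ ≤ 1 / 4 * (η * ‖e₁‖) := by gcongr
  calc _ ≤ 1 / 4 * (η * ‖e₁‖) + η * ‖e₁‖ + η * ‖e₂‖ :=
        norm_sub_le_of_le (norm_sub_le_of_le hcross (hproj 0 e₁)) (hproj 1 e₂)
    _ ≤ 1 / 4 * (η * (ρ * S * ‖w - u‖)) + η * (ρ * S * ‖w - u‖) +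
          η * (ρ * S * ((1 + 1 / 4) * ‖w - u‖)) := by
        gcongr
        exact he₂.trans (by gcongr; exact hhalf.trans (by gcongr))
    _ ≤ 4 * η * ρ * S * ‖w - u‖ := by
        have : 0 ≤ η * (ρ * S * ‖w - u‖) := by positivity
        linarith

namespace IsBlockSmooth

theorem sq_norm_agdStep_sub_le (h : IsBlockSmooth blk f Lb Lt) (hη : 0 ≤ η)
    (hηL : η * blockLmax Lb Lt ≤ 1 / 2) (x : EuclideanSpace ℝ (Fin d)) :
    ‖agdStep blk f η x - x‖ ^ 2 ≤ 2 * η * (f x - f (agdStep blk f η x)) := by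
  rw [sq_norm_agdStep_sub]
  linarith [mul_le_mul_of_nonneg_left (h.agdStep_le hη hηL x) hη]

theorem antitone_iterate (h : IsBlockSmooth blk f Lb Lt) (hη : 0 ≤ η)
    (hηL : η * blockLmax Lb Lt ≤ 1 / 2) (u : EuclideanSpace ℝ (Fin d)) :
    Antitone fun n => f ((agdStep blk f η)^[n] u) := by
  refine antitone_nat_of_succ_le fun n => ?_
  rw [Function.iterate_succ_apply']
  refine (h.agdStep_le hη hηL _).trans (sub_le_self _ ?_)
  rw [agdGradSq]
  positivity

theorem apply_le_add_of_agdGradSq_le (h : IsBlockSmooth blk f Lb Lt) (hM : 0 ≤ blockLmax Lb Lt)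
    (hη : 0 ≤ η) (hηL : η * blockLmax Lb Lt ≤ 1 / 4) (hg : 0 ≤ g)
    {x u : EuclideanSpace ℝ (Fin d)} (hx : agdGradSq blk f η x ≤ g ^ 2)
    (hu : ‖u - x‖ ≤ η * g) : f u ≤ f x + 3 * (η * g ^ 2) :=
  calc f u ≤ f x + (‖gradient f x‖ + 4 * blockLmax Lb Lt * (η * g)) * (η * g) :=
        apply_le_add_of_norm_sub_le h.1 (by positivity) (h.norm_gradient_sub_le hM) hu
    _ = f x + (‖gradient f x‖ + 4 * (η * blockLmax Lb Lt) * g) * (η * g) := by ring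
    _ ≤ f x + (2 * g + 4 * (1 / 4) * g) * (η * g) := by
        gcongr
        exact h.norm_gradient_le hη (by linarith) hg hx
    _ = f x + 3 * (η * g ^ 2) := by ring

end IsBlockSmooth

/-- The perturbed point `u`, at distance at most `η * g` from `x`, is *stuck*: `K` alternating
gradient steps from `u` do not bring the objective down to `f x - η * g ^ 2`. -/
structure IsStuck (blk : Fin d → Fin 2) (f : EuclideanSpace ℝ (Fin d) → ℝ) (η g : ℝ) (K : ℕ)
    (x u : EuclideanSpace ℝ (Fin d)) : Prop where
  norm_sub_le : ‖u - x‖ ≤ η * g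
  lt_apply_iterate_sub : -(η * g ^ 2) < f ((agdStep blk f η)^[K] u) - f x

namespace IsStuck

variable {K : ℕ} {x u : EuclideanSpace ℝ (Fin d)}

theorem apply_iterate_sub_le (hu : IsStuck blk f η g K x u) (h : IsBlockSmooth blk f Lb Lt)
    (hM : 0 ≤ blockLmax Lb Lt) (hη : 0 ≤ η) (hηL : η * blockLmax Lb Lt ≤ 1 / 4) (hg : 0 ≤ g)
    (hx : agdGradSq blk f η x ≤ g ^ 2) (m : ℕ) {n : ℕ} (hn : n ≤ K) :
    f ((agdStep blk f η)^[m] u) - f ((agdStep blk f η)^[n] u) ≤ 4 * (η * g ^ 2) := by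
  have hanti := h.antitone_iterate hη (by linarith) u
  have hstart : f ((agdStep blk f η)^[m] u) ≤ f u := hanti (Nat.zero_le m)
  have hend : f ((agdStep blk f η)^[K] u) ≤ f ((agdStep blk f η)^[n] u) := hanti hn
  linarith [h.apply_le_add_of_agdGradSq_le hM hη hηL hg hx hu.norm_sub_le,
    hu.lt_apply_iterate_sub]

theorem norm_iterate_sub_start_le (hu : IsStuck blk f η g K x u)
    (h : IsBlockSmooth blk f Lb Lt) (hM : 0 ≤ blockLmax Lb Lt) (hη : 0 ≤ η)
    (hηL : η * blockLmax Lb Lt ≤ 1 / 4) (hg : 0 ≤ g) (hx : agdGradSq blk f η x ≤ g ^ 2) {n : ℕ}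
    (hn : n ≤ K) : ‖(agdStep blk f η)^[n] u - u‖ ≤ 3 * √K * (η * g) := by
  have htravel := sq_norm_sub_le_of_forall_sq_norm_sub_le
    (z := fun n => (agdStep blk f η)^[n] u) (φ := fun n => f ((agdStep blk f η)^[n] u))
    (fun n => by
      simp only [Function.iterate_succ_apply']
      exact h.sq_norm_agdStep_sub_le hη (by linarith) _) n
  refine (sq_le_sq₀ (norm_nonneg _) (by positivity)).1 (htravel.trans ?_)
  calc (n : ℝ) * (2 * η * (f ((agdStep blk f η)^[0] u) - f ((agdStep blk f η)^[n] u)))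
      ≤ n * (2 * η * (4 * (η * g ^ 2))) := by
        gcongr
        exact hu.apply_iterate_sub_le h hM hη hηL hg hx 0 hn
    _ ≤ K * (2 * η * (4 * (η * g ^ 2))) := by gcongr
    _ = 8 * (K * (η * g) ^ 2) := by ring
    _ ≤ 9 * (K * (η * g) ^ 2) := by gcongr; norm_num
    _ = 9 * (√K ^ 2 * (η * g) ^ 2) := by rw [Real.sq_sqrt (by positivity)]
    _ = (3 * √K * (η * g)) ^ 2 := by ring

theorem norm_agdHalf_iterate_sub_iterate_le (hu : IsStuck blk f η g K x u)
    (h : IsBlockSmooth blk f Lb Lt) (hM : 0 ≤ blockLmax Lb Lt) (hη : 0 ≤ η)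
    (hηL : η * blockLmax Lb Lt ≤ 1 / 4) (hg : 0 ≤ g) (hx : agdGradSq blk f η x ≤ g ^ 2) {n : ℕ}
    (hn : n < K) :
    ‖agdHalf blk f η ((agdStep blk f η)^[n] u) - (agdStep blk f η)^[n] u‖ ≤ 3 * (η * g) := by
  refine (norm_agdHalf_sub_le η _).trans ((sq_le_sq₀ (norm_nonneg _) (by positivity)).1 ?_)
  have hdrop := hu.apply_iterate_sub_le h hM hη hηL hg hx n (n := n + 1) hn
  rw [Function.iterate_succ_apply'] at hdrop
  calc _ ≤ _ := h.sq_norm_agdStep_sub_le hη (by linarith) _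
    _ ≤ 2 * η * (4 * (η * g ^ 2)) := by gcongr
    _ ≤ (3 * (η * g)) ^ 2 := by nlinarith [sq_nonneg (η * g)]

theorem norm_iterate_sub_le (hu : IsStuck blk f η g K x u) (h : IsBlockSmooth blk f Lb Lt)
    (hM : 0 ≤ blockLmax Lb Lt) (hη : 0 ≤ η) (hηL : η * blockLmax Lb Lt ≤ 1 / 4) (hg : 0 ≤ g)
    (hK : 16 ≤ K) (hx : agdGradSq blk f η x ≤ g ^ 2) {n : ℕ} (hn : n ≤ K) :
    ‖(agdStep blk f η)^[n] u - x‖ ≤ 4 * √K * (η * g) := by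
  have hsqrt : 4 ≤ √K := Real.le_sqrt_of_sq_le (by norm_num; exact_mod_cast hK)
  have hclose := norm_sub_le_norm_sub_add_norm_sub ((agdStep blk f η)^[n] u) u x
  have htravel := hu.norm_iterate_sub_start_le h hM hη hηL hg hx hn
  nlinarith [hu.norm_sub_le, mul_le_mul_of_nonneg_right hsqrt (mul_nonneg hη hg),
    mul_nonneg hη hg]

theorem norm_agdHalf_iterate_sub_le (hu : IsStuck blk f η g K x u)
    (h : IsBlockSmooth blk f Lb Lt) (hM : 0 ≤ blockLmax Lb Lt) (hη : 0 ≤ η)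
    (hηL : η * blockLmax Lb Lt ≤ 1 / 4) (hg : 0 ≤ g) (hK : 16 ≤ K)
    (hx : agdGradSq blk f η x ≤ g ^ 2) {n : ℕ} (hn : n < K) :
    ‖agdHalf blk f η ((agdStep blk f η)^[n] u) - x‖ ≤ 4 * √K * (η * g) := by
  have hsqrt : 4 ≤ √K := Real.le_sqrt_of_sq_le (by norm_num; exact_mod_cast hK)
  have hclose := norm_sub_le_norm_sub_add_norm_sub ((agdStep blk f η)^[n] u) u x
  have htravel := hu.norm_iterate_sub_start_le h hM hη hηL hg hx hn.le
  have hhalf := hu.norm_agdHalf_iterate_sub_iterate_le h hM hη hηL hg hx hn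
  have htri := norm_sub_le_norm_sub_add_norm_sub
    (agdHalf blk f η ((agdStep blk f η)^[n] u)) ((agdStep blk f η)^[n] u) x
  nlinarith [hu.norm_sub_le, mul_le_mul_of_nonneg_right hsqrt (mul_nonneg hη hg)]

end IsStuck

theorem exists_escape_direction (h : IsBlockSmooth blk f Lb Lt) (hM : 0 ≤ blockLmax Lb Lt)
    (hH : IsHessianLipschitz f ρ) (hρ : 0 ≤ ρ) {γ : ℝ} (hη : 0 < η)
    (hηL : η * blockLmax Lb Lt ≤ 1 / 16) (hg : 0 ≤ g) {K : ℕ} (hK : 16 ≤ K)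
    (hlin : 2 * (2 * (1 + √(8 * K * (η * (4 * blockLmax Lb Lt))))) *
      (4 * η * ρ * (4 * √K * (η * g))) * K ≤ 1 / 2)
    {x v : EuclideanSpace ℝ (Fin d)} (hx : agdGradSq blk f η x ≤ g ^ 2)
    (hγ : 0 ≤ γ) (hv : ‖v‖ = 1) (hvH : ⟪v, hessian f x v⟫ ≤ -γ) :
    ∃ φ : EuclideanSpace ℝ (Fin d), ‖φ‖ = 1 ∧ ∀ (u : EuclideanSpace ℝ (Fin d)) (s : ℝ), 0 ≤ s →
      IsStuck blk f η g K x u → IsStuck blk f η g K x (u + s • φ) →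
      (1 + η * γ / 2) ^ K * s ≤ 16 * √K * (η * g) := by
  have hHess := h.norm_hessian_le hM x
  have hηH : η * ‖hessian f x‖ ≤ 1 / 4 :=
    (mul_le_mul_of_nonneg_left hHess hη.le).trans (by linarith)
  obtain ⟨l, hl, ⟨φ, hφ, hφA⟩, hpow⟩ := (isBlockSplit_blockProj blk
    zero_ne_one).exists_left_eigenvector (hH.isSymmetric_hessian x) hη hηH hγ hv hvH
  have hl1 : 1 ≤ l := le_trans (by have := mul_nonneg hη.le hγ; linarith) hl
  have hηL' : η * blockLmax Lb Lt ≤ 1 / 4 := by linarith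
  refine ⟨φ, hφ, fun u s hs hu hw => ?_⟩
  have hgrowth : l ^ K * s / 2 ≤
      ‖(agdStep blk f η)^[K] (u + s • φ) - (agdStep blk f η)^[K] u‖ :=
    pow_mul_le_norm_of_nearly_linear (κ := 4 * η * ρ * (4 * √K * (η * g)))
      (v := fun n => (agdStep blk f η)^[n] (u + s • φ) - (agdStep blk f η)^[n] u)
      hl1 (by positivity) (by positivity) hs hφ hφA
      (fun n _ w => (hpow n w).trans (by gcongr)) (by simp)
      (fun n hn => by
        simp only [Function.iterate_succ_apply']
        exact h.norm_agdStep_sub_altStep_le hM hH hρ hη.le hηL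
          (hu.norm_iterate_sub_le h hM hη.le hηL' hg hK hx hn.le)
          (hw.norm_iterate_sub_le h hM hη.le hηL' hg hK hx hn.le)
          (hu.norm_agdHalf_iterate_sub_le h hM hη.le hηL' hg hK hx hn)
          (hw.norm_agdHalf_iterate_sub_le h hM hη.le hηL' hg hK hx hn)) hlin
  have hclose : ‖(agdStep blk f η)^[K] (u + s • φ) - (agdStep blk f η)^[K] u‖ ≤
      4 * √K * (η * g) + 4 * √K * (η * g) := by
    rw [← sub_sub_sub_cancel_right _ _ x]
    exact norm_sub_le_of_le (hw.norm_iterate_sub_le h hM hη.le hηL' hg hK hx le_rfl)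
      (hu.norm_iterate_sub_le h hM hη.le hηL' hg hK hx le_rfl)
  calc (1 + η * γ / 2) ^ K * s ≤ l ^ K * s := by gcongr
    _ ≤ 16 * √K * (η * g) := by linarith

end Trajectories

section ThinSets

variable {E : Type*} [NormedAddCommGroup E] [NormedSpace ℝ E] {A : Set E} {φ : E} {r w : ℝ}

/-- Two points of `A` on a common line in the direction `φ` differ by less than `w • φ`. The stuck
starting points around a saddle form such a set. -/
def IsThinAlong (A : Set E) (φ : E) (w : ℝ) : Prop :=
  ∀ (u : E) (s : ℝ), 0 ≤ s → u ∈ A → u + s • φ ∈ A → s < w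

variable [MeasurableSpace E] [BorelSpace E]

theorem IsThinAlong.natCast_mul_measure_le (hthin : IsThinAlong A φ w) (μ : Measure E)
    [μ.IsAddRightInvariant] (hA : MeasurableSet A) (hAr : A ⊆ Metric.ball 0 r) (hw : 0 ≤ w)
    (hφ : ‖φ‖ = 1) (m : ℕ) : m * μ A ≤ μ (Metric.ball 0 (r + m * w)) := by
  set T : ℕ → Set E := fun j => (fun y => y + -((j * w) • φ)) ⁻¹' A
  have hTA : ∀ j, μ (T j) = μ A := fun j => measure_preimage_add_right _ _ _
  have hTmeas : ∀ j, MeasurableSet (T j) := fun j => measurable_add_const _ hA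
  have hTdisj : Pairwise (Function.onFun Disjoint T) := by
    refine (pairwise_disjoint_on T).2 fun j k hjk => Set.disjoint_left.2 fun y hyj hyk => ?_
    have hgap : (j : ℝ) + 1 ≤ k := by exact_mod_cast hjk
    have hshift : y + -((k * w) • φ) + ((k - j) * w) • φ = y + -((j * w) • φ) := by module
    have hlt : (k - j) * w < w :=
      hthin (y + -((k * w) • φ)) _ (mul_nonneg (by linarith) hw) hyk (by rwa [hshift])
    nlinarith
  have hTball : (⋃ j ∈ Finset.range m, T j) ⊆ Metric.ball 0 (r + m * w) := by
    refine Set.iUnion₂_subset fun j hj y hy => ?_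
    have hyA : ‖y + -((j * w) • φ)‖ < r := mem_ball_zero_iff.1 (hAr hy)
    have hjm : (j : ℝ) * w ≤ m * w := by gcongr; exact (Finset.mem_range.1 hj).le
    have htri := norm_add_le (y + -((j * w) • φ)) ((j * w) • φ)
    rw [neg_add_cancel_right, norm_smul (_ * _), hφ, Real.norm_of_nonneg (by positivity)] at htri
    exact mem_ball_zero_iff.2 (by linarith)
  calc m * μ A = ∑ j ∈ Finset.range m, μ (T j) := by simp [hTA]
    _ = μ (⋃ j ∈ Finset.range m, T j) :=
        (measure_biUnion_finset (hTdisj.set_pairwise _) fun j _ => hTmeas j).symm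
    _ ≤ μ (Metric.ball 0 (r + m * w)) := measure_mono hTball

theorem measure_ball_mul_one_add_inv_finrank_le [FiniteDimensional ℝ E] (μ : Measure E)
    [μ.IsAddHaarMeasure] (r : ℝ) :
    μ (Metric.ball 0 ((1 + (Module.finrank ℝ E : ℝ)⁻¹) * r)) ≤ 3 * μ (Metric.ball 0 r) := by
  rw [Measure.addHaar_ball_mul_of_pos _ _ (by positivity)]
  gcongr
  rw [← ENNReal.ofReal_ofNat 3]
  gcongr
  exact Real.one_add_inv_pow_le_exp.trans (Real.exp_one_lt_d9.le.trans (by norm_num))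

theorem uniformBall_le_of_isThinAlong {d : ℕ} {r : ℝ} (hr : 0 < r) {m : ℕ} (hm : m ≠ 0)
    {A : Set (EuclideanSpace ℝ (Fin d))} (hA : MeasurableSet A) {φ : EuclideanSpace ℝ (Fin d)}
    (hφ : ‖φ‖ = 1) (hthin : IsThinAlong (Metric.ball 0 r ∩ A) φ (r / (d * m))) :
    uniformBall d r A ≤ ENNReal.ofReal (3 / m) := by
  have hradius : r + m * (r / (d * m)) = (1 + (d : ℝ)⁻¹) * r := by
    rcases eq_or_ne d 0 with rfl | hd
    · simp
    · field_simp
  set B := Metric.ball (0 : EuclideanSpace ℝ (Fin d)) r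
  have hvol : m * volume (B ∩ A) ≤ 3 * volume B := by
    have hball := measure_ball_mul_one_add_inv_finrank_le
      (volume : Measure (EuclideanSpace ℝ (Fin d))) r
    rw [finrank_euclideanSpace_fin, ← hradius] at hball
    exact (hthin.natCast_mul_measure_le volume (Metric.isOpen_ball.measurableSet.inter hA)
      Set.inter_subset_left (by positivity) hφ m).trans hball
  have hB₀ : volume B ≠ 0 := (Metric.measure_ball_pos volume 0 hr).ne'
  rw [uniformBall, cond_apply Metric.isOpen_ball.measurableSet, mul_comm, ← div_eq_mul_inv,
    ENNReal.ofReal_div_of_pos (by positivity), ENNReal.ofReal_natCast, ENNReal.ofReal_ofNat,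
    ENNReal.div_le_iff hB₀ measure_ball_lt_top.ne, ENNReal.mul_comm_div, ← mul_div_assoc,
    ENNReal.le_div_iff_mul_le (by simp [hm]) (by simp), mul_comm]
  exact hvol

end ThinSets

/-! ### The parameters of the algorithm -/

theorem exp_mul_half_le_one_add_pow {y : ℝ} (hy : 0 ≤ y) (hy1 : y ≤ 1) (n : ℕ) :
    Real.exp (n * (y / 2)) ≤ (1 + y) ^ n := by
  rw [Real.exp_nat_mul]
  gcongr
  calc Real.exp (y / 2) = (Real.exp (-(y / 2)))⁻¹ := by rw [Real.exp_neg, inv_inv]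
    _ ≤ (1 - y / 2)⁻¹ := by
        gcongr
        · linarith
        · exact Real.one_sub_le_exp_neg _
    _ ≤ 1 + y := inv_le_of_inv_le₀ (by linarith) (by
        rw [inv_le_iff_one_le_mul₀ (by linarith)]
        nlinarith)

theorem pow_seven_mul_exp_lt_exp_div {c X : ℝ} (hc : 0 < c) (hc' : c ≤ 1 / 10000)
    (hX : 48 ≤ X) : 224 / c ^ 2 * X ^ 7 * Real.exp X < Real.exp (X / (4 * c)) := by
  have hfactorial := fun n => Real.pow_div_factorial_le_exp X (by linarith) n
  have hX7 : X ^ 7 ≤ 5040 * Real.exp X := by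
    have := hfactorial 7
    rw [div_le_iff₀ (by positivity)] at this
    norm_num [Nat.factorial] at this
    linarith
  have hX5 : 224 * 5040 ≤ Real.exp X :=
    calc (224 * 5040 : ℝ) ≤ 48 ^ 5 / Nat.factorial 5 := by norm_num [Nat.factorial]
      _ ≤ X ^ 5 / Nat.factorial 5 := by gcongr
      _ ≤ Real.exp X := hfactorial 5
  have hc2 : 1 / c ^ 2 ≤ Real.exp (2 / c) :=
    calc 1 / c ^ 2 = (1 / c) ^ 2 := (one_div_pow c 2).symm
      _ ≤ Real.exp (1 / c) ^ 2 := by gcongr; linarith [Real.add_one_le_exp (1 / c)]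
      _ = Real.exp (2 / c) := by rw [← Real.exp_nat_mul]; ring_nf
  calc 224 / c ^ 2 * X ^ 7 * Real.exp X = 224 * (1 / c ^ 2) * X ^ 7 * Real.exp X := by ring
    _ ≤ 224 * Real.exp (2 / c) * (5040 * Real.exp X) * Real.exp X := by gcongr
    _ = 224 * 5040 * (Real.exp (2 / c) * Real.exp X * Real.exp X) := by ring
    _ ≤ Real.exp X * (Real.exp (2 / c) * Real.exp X * Real.exp X) := by gcongr
    _ = Real.exp (2 / c + 3 * X) := by simp only [← Real.exp_add]; ring_nf
    _ < Real.exp (X / (4 * c)) := by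
        gcongr
        rw [lt_div_iff₀ (by positivity), add_mul,
          show 2 / c * (4 * c) = 8 by field_simp; norm_num]
        nlinarith

/-- The constant `C` of the iteration bound, in terms of the step size constant `c`. -/
noncomputable def iterationConst (c : ℝ) : ℝ := 3 * 6 ^ 7 / c ^ 7 * (1 + 6 / c ^ 2)

theorem iterationConst_pos {c : ℝ} (hc : 0 < c) : 0 < iterationConst c := by
  rw [iterationConst]
  positivity

namespace PAGDParams

/-- The parameter regime of the convergence analysis: that of the theorem, with the absolute
constant `1 / 10000` bounding `c`. -/
structure Admissible (p : PAGDParams) : Prop where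
  d_pos : 0 < p.d
  c_pos : 0 < p.c
  c_le : p.c ≤ 1 / 10000
  Lmax_pos : 0 < p.Lmax
  Lmax_le : p.Lmax ≤ p.L
  ρ_pos : 0 < p.ρ
  ε_pos : 0 < p.ε
  ε_le : p.ε ≤ p.Lmax ^ 2 / p.ρ
  δ_pos : 0 < p.δ
  δ_le : p.δ ≤ 1
  Δ_nonneg : 0 ≤ p.Δ

theorem le_χ (p : PAGDParams) : 24 ≤ p.χ := by
  rw [χ]; linarith [le_max_right p.logFactor 4]

theorem χ_pos (p : PAGDParams) : 0 < p.χ := by linarith [p.le_χ]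

namespace Admissible

variable {p : PAGDParams}

theorem two_le_P₁ (hp : p.Admissible) : 2 ≤ p.P₁ := by
  rw [P₁]
  linarith [(one_le_div hp.Lmax_pos).2 hp.Lmax_le]

theorem P₁_pos (hp : p.Admissible) : 0 < p.P₁ := by linarith [hp.two_le_P₁]

theorem one_le_P₂ (hp : p.Admissible) : 1 ≤ p.P₂ := by
  have hd : (1 : ℝ) ≤ p.d := by exact_mod_cast hp.d_pos
  have hlog : 0 ≤ Real.log (2 * (p.d : ℝ)) := Real.log_nonneg (by linarith)
  have hL : 0 ≤ p.L := hp.Lmax_pos.le.trans hp.Lmax_le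
  exact le_add_of_nonneg_right (div_nonneg (mul_nonneg hL hlog) hp.Lmax_pos.le)

theorem P₂_pos (hp : p.Admissible) : 0 < p.P₂ := one_pos.trans_le hp.one_le_P₂

theorem Lmax_mul_ρ_mul_ε_pos (hp : p.Admissible) : 0 < p.Lmax * p.ρ * p.ε :=
  mul_pos (mul_pos hp.Lmax_pos hp.ρ_pos) hp.ε_pos

theorem γ_pos (hp : p.Admissible) : 0 < p.γ := Real.rpow_pos_of_pos hp.Lmax_mul_ρ_mul_ε_pos _

theorem γ_cube (hp : p.Admissible) : p.γ ^ 3 = p.Lmax * p.ρ * p.ε := by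
  rw [γ, ← Real.rpow_natCast, ← Real.rpow_mul hp.Lmax_mul_ρ_mul_ε_pos.le]
  norm_num

theorem γ_le (hp : p.Admissible) : p.γ ≤ p.Lmax := by
  refine le_of_pow_le_pow_left₀ three_ne_zero hp.Lmax_pos.le ?_
  have hρε := (le_div_iff₀ hp.ρ_pos).1 hp.ε_le
  calc p.γ ^ 3 = p.Lmax * (p.ε * p.ρ) := by rw [hp.γ_cube]; ring
    _ ≤ p.Lmax * p.Lmax ^ 2 := mul_le_mul_of_nonneg_left hρε hp.Lmax_pos.le
    _ = p.Lmax ^ 3 := by ring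

theorem rpow_quotient_eq (hp : p.Admissible) (a : ℝ) :
    p.Lmax ^ ((5 : ℝ) / 3) * a / (p.ρ ^ ((1 : ℝ) / 3) * p.ε ^ ((7 : ℝ) / 3)) =
      p.Lmax ^ 2 * a / (p.γ * p.ε ^ 2) := by
  have hLmax := hp.Lmax_pos
  have hρ := hp.ρ_pos
  have hε := hp.ε_pos
  have hLmax_sq : p.Lmax ^ 2 = p.Lmax ^ ((5 : ℝ) / 3) * p.Lmax ^ ((1 : ℝ) / 3) := by
    rw [← Real.rpow_add hLmax, ← Real.rpow_natCast]; norm_num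
  have hε_rpow : p.ε ^ ((7 : ℝ) / 3) = p.ε ^ 2 * p.ε ^ ((1 : ℝ) / 3) := by
    rw [← Real.rpow_natCast, ← Real.rpow_add hε]; norm_num
  rw [γ, Real.mul_rpow (by positivity) hε.le, Real.mul_rpow hLmax.le hρ.le, hLmax_sq, hε_rpow]
  field_simp

theorem rate_eq (hp : p.Admissible) :
    p.rate = p.Lmax ^ 2 * p.P₁ ^ 7 * p.P₂ ^ 2 * p.Δ / (p.γ * p.ε ^ 2) := by
  have := hp.rpow_quotient_eq (p.P₁ ^ 7 * p.P₂ ^ 2 * p.Δ)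
  rw [rate]
  simpa only [mul_assoc] using this

theorem rate_nonneg (hp : p.Admissible) : 0 ≤ p.rate := by
  have := hp.P₁_pos; have := hp.P₂_pos; have := hp.γ_pos; have := hp.Δ_nonneg
  rw [hp.rate_eq]
  positivity

theorem logFactor_eq (hp : p.Admissible) : p.logFactor =
    Real.log (p.P₁ ^ 6 * p.P₂ ^ 2 * p.d * p.Lmax ^ 2 * p.Δ /
      (p.c ^ 5 * p.γ * p.ε ^ 2 * p.δ)) := by
  have hc := hp.c_pos
  have hδ := hp.δ_pos
  rw [logFactor]
  congr 1
  calc _ = p.Lmax ^ ((5 : ℝ) / 3) * (p.P₁ ^ 6 * p.P₂ ^ 2 * p.d * p.Δ / (p.c ^ 5 * p.δ)) /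
        (p.ρ ^ ((1 : ℝ) / 3) * p.ε ^ ((7 : ℝ) / 3)) := by field_simp
    _ = p.Lmax ^ 2 * (p.P₁ ^ 6 * p.P₂ ^ 2 * p.d * p.Δ / (p.c ^ 5 * p.δ)) /
        (p.γ * p.ε ^ 2) := hp.rpow_quotient_eq _
    _ = _ := by field_simp

theorem η_pos (hp : p.Admissible) : 0 < p.η := div_pos hp.c_pos hp.Lmax_pos

theorem η_mul_Lmax (hp : p.Admissible) : p.η * p.Lmax = p.c :=
  div_mul_cancel₀ _ hp.Lmax_pos.ne'

theorem η_mul_Lmax_le (hp : p.Admissible) : p.η * p.Lmax ≤ 1 / 16 := by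
  rw [hp.η_mul_Lmax]; linarith [hp.c_le]

theorem gth_pos (hp : p.Admissible) : 0 < p.gth := by
  have hc := hp.c_pos; have hε := hp.ε_pos; have hP₁ := hp.P₁_pos; have hP₂ := hp.P₂_pos
  have hχ := p.χ_pos
  rw [gth]; positivity

theorem r_eq (hp : p.Admissible) : p.r = p.η * p.gth := by
  have hLmax := hp.Lmax_pos; have hP₁ := hp.P₁_pos; have hP₂ := hp.P₂_pos
  have hχ := p.χ_pos
  rw [r, η, gth]; field_simp

theorem fth_eq (hp : p.Admissible) : p.fth = p.η * p.gth ^ 2 := by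
  have hLmax := hp.Lmax_pos; have hP₁ := hp.P₁_pos; have hP₂ := hp.P₂_pos
  have hχ := p.χ_pos
  rw [fth, η, gth]; field_simp

theorem r_pos (hp : p.Admissible) : 0 < p.r := hp.r_eq ▸ mul_pos hp.η_pos hp.gth_pos

theorem fth_pos (hp : p.Admissible) : 0 < p.fth :=
  hp.fth_eq ▸ mul_pos hp.η_pos (pow_pos hp.gth_pos 2)

theorem le_χ_mul_P₁ (hp : p.Admissible) : 48 ≤ p.χ * p.P₁ := by
  nlinarith [p.le_χ, hp.two_le_P₁]

theorem one_le_pow_mul_P₂ (hp : p.Admissible) (k : ℕ) : 1 ≤ (p.χ * p.P₁) ^ k * p.P₂ :=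
  one_le_mul_of_one_le_of_one_le (one_le_pow₀ (by linarith [hp.le_χ_mul_P₁])) hp.one_le_P₂

theorem gth_le (hp : p.Admissible) : p.gth ≤ p.ε / 4 := by
  have hε := hp.ε_pos
  have hc : p.c ^ 2 ≤ 1 / 4 := by nlinarith [hp.c_le, hp.c_pos]
  calc p.gth ≤ p.c ^ 2 * p.ε := div_le_self (by positivity) (hp.one_le_pow_mul_P₂ 3)
    _ ≤ 1 / 4 * p.ε := by gcongr
    _ = p.ε / 4 := by ring

theorem fth_le (hp : p.Admissible) : p.fth ≤ p.ε ^ 2 / (16 * p.Lmax) := by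
  have hLmax := hp.Lmax_pos
  have hg := hp.gth_pos
  have hη : p.η ≤ 1 / p.Lmax := by
    rw [η]; gcongr; linarith [hp.c_le]
  calc p.fth = p.η * p.gth ^ 2 := hp.fth_eq
    _ ≤ 1 / p.Lmax * (p.ε / 4) ^ 2 := by gcongr; exact hp.gth_le
    _ = p.ε ^ 2 / (16 * p.Lmax) := by ring

theorem le_c_sq_mul_tth (hp : p.Admissible) : 48 ≤ p.c ^ 2 * p.tth := by
  have hc := hp.c_pos; have hLmax := hp.Lmax_pos; have hγ := hp.γ_pos
  calc (48 : ℝ) ≤ p.χ * p.P₁ * (p.Lmax / p.γ) :=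
        hp.le_χ_mul_P₁.trans (le_mul_of_one_le_right (by linarith [hp.le_χ_mul_P₁])
          ((one_le_div hγ).2 hp.γ_le))
    _ = p.c ^ 2 * p.tth := by rw [tth]; field_simp

theorem one_le_c_mul_tth (hp : p.Admissible) : 1 ≤ p.c * p.tth := by
  nlinarith [hp.le_c_sq_mul_tth, hp.c_le, hp.c_pos]

theorem le_tth (hp : p.Admissible) : 100 ≤ p.tth := by
  nlinarith [hp.one_le_c_mul_tth, hp.c_le, hp.c_pos]

theorem tth_pos (hp : p.Admissible) : 0 < p.tth := by linarith [hp.le_tth]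

theorem ceil_tth_le (hp : p.Admissible) : (⌈p.tth⌉₊ : ℝ) ≤ 2 * p.tth := by
  linarith [Nat.ceil_lt_add_one hp.tth_pos.le, hp.le_tth]

theorem le_ceil_tth (hp : p.Admissible) : 16 ≤ ⌈p.tth⌉₊ := by
  have : (16 : ℝ) ≤ ⌈p.tth⌉₊ := by linarith [Nat.le_ceil p.tth, hp.le_tth]
  exact_mod_cast this

theorem η_mul_ρ_mul_r_mul_sq_le (hp : p.Admissible) :
    p.η * p.ρ * p.r * (⌈p.tth⌉₊ : ℝ) ^ 2 ≤ 1 / 12 := by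
  have hη := hp.η_pos; have hρ := hp.ρ_pos; have hr := hp.r_pos; have hLmax := hp.Lmax_pos
  have hc := hp.c_pos; have hP₁ := hp.P₁_pos; have hP₂ := hp.P₂_pos; have hχ := p.χ_pos
  have hγ := hp.γ_pos
  calc p.η * p.ρ * p.r * (⌈p.tth⌉₊ : ℝ) ^ 2 ≤ p.η * p.ρ * p.r * (2 * p.tth) ^ 2 := by
        gcongr; exact hp.ceil_tth_le
    _ = 4 * p.γ / (p.Lmax * (p.χ * p.P₁) * p.P₂) := by
        rw [η, r, tth]
        field_simp
        linear_combination -4 * hp.γ_cube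
    _ ≤ 4 * p.Lmax / (p.Lmax * 48 * 1) := by
        gcongr
        · exact hp.γ_le
        · exact hp.le_χ_mul_P₁
        · exact hp.one_le_P₂
    _ = 1 / 12 := by field_simp; norm_num

theorem linearization_error_le (hp : p.Admissible) :
    2 * (2 * (1 + √(8 * ⌈p.tth⌉₊ * (p.η * (4 * p.Lmax))))) *
      (4 * p.η * p.ρ * (4 * √⌈p.tth⌉₊ * (p.η * p.gth))) * ⌈p.tth⌉₊ ≤ 1 / 2 := by
  have hη := hp.η_pos; have hρ := hp.ρ_pos; have hr := hp.r_pos; have hc := hp.c_pos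
  have herror := hp.η_mul_ρ_mul_r_mul_sq_le
  have hcK : 1 ≤ p.c * ⌈p.tth⌉₊ := hp.one_le_c_mul_tth.trans (by gcongr; exact Nat.le_ceil _)
  rw [← hp.r_eq]
  set K : ℝ := (⌈p.tth⌉₊ : ℝ)
  have hK : 0 ≤ K := Nat.cast_nonneg _
  have hsqrtc : √p.c ≤ 1 / 100 := Real.sqrt_le_iff.2 ⟨by norm_num, by linarith [hp.c_le]⟩
  have hsqrt : √(8 * K * (p.η * (4 * p.Lmax))) ≤ 6 * (√p.c * √K) := by
    rw [← Real.sqrt_mul hc.le, mul_left_comm p.η, hp.η_mul_Lmax]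
    refine Real.sqrt_le_iff.2 ⟨by positivity, ?_⟩
    rw [mul_pow, Real.sq_sqrt (by positivity)]
    linarith
  have hone : 1 ≤ √p.c * √K := by rwa [← Real.sqrt_mul hc.le, Real.one_le_sqrt]
  calc 2 * (2 * (1 + √(8 * K * (p.η * (4 * p.Lmax))))) * (4 * p.η * p.ρ * (4 * √K * p.r)) * K
      ≤ 2 * (2 * (√p.c * √K + 6 * (√p.c * √K))) * (4 * p.η * p.ρ * (4 * √K * p.r)) * K := by
        gcongr
    _ = 448 * √p.c * (p.η * p.ρ * p.r * (√K ^ 2 * K)) := by ring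
    _ = 448 * √p.c * (p.η * p.ρ * p.r * K ^ 2) := by rw [Real.sq_sqrt hK]; ring
    _ ≤ 448 * (1 / 100) * (1 / 12) := by gcongr
    _ ≤ 1 / 2 := by norm_num

theorem exp_le_growth (hp : p.Admissible) :
    Real.exp (p.χ * p.P₁ / (4 * p.c)) ≤ (1 + p.η * p.γ / 2) ^ ⌈p.tth⌉₊ := by
  have hη := hp.η_pos; have hγ := hp.γ_pos; have hc := hp.c_pos; have hLmax := hp.Lmax_pos
  have hrate : p.η * p.γ / 2 ≤ 1 := by
    have := mul_le_mul_of_nonneg_left hp.γ_le hη.le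
    linarith [hp.η_mul_Lmax_le]
  calc Real.exp (p.χ * p.P₁ / (4 * p.c)) = Real.exp (p.tth * (p.η * p.γ / 2 / 2)) := by
        congr 1; rw [tth, η]; field_simp; norm_num
    _ ≤ Real.exp (⌈p.tth⌉₊ * (p.η * p.γ / 2 / 2)) := by gcongr; exact Nat.le_ceil _
    _ ≤ (1 + p.η * p.γ / 2) ^ ⌈p.tth⌉₊ :=
        exp_mul_half_le_one_add_pow (by positivity) hrate _

theorem logFactor_le (hp : p.Admissible) : p.logFactor ≤ p.χ * p.P₁ := by
  have hχ : p.logFactor ≤ p.χ := by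
    rw [χ]; linarith [le_max_left p.logFactor 4, le_max_right p.logFactor 4]
  exact hχ.trans (le_mul_of_one_le_right p.χ_pos.le (by linarith [hp.two_le_P₁]))

theorem d_mul_gap_le (hp : p.Admissible) (hΔ : 0 < p.Δ) :
    p.d * (p.Δ / (p.fth * p.δ)) ≤ p.χ ^ 6 * (p.γ / p.Lmax) * Real.exp (p.χ * p.P₁) := by
  have hc := hp.c_pos; have hε := hp.ε_pos; have hP₁ := hp.P₁_pos; have hP₂ := hp.P₂_pos
  have hLmax := hp.Lmax_pos; have hγ := hp.γ_pos; have hδ := hp.δ_pos; have hχ := p.χ_pos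
  have hd : (0 : ℝ) < p.d := by exact_mod_cast hp.d_pos
  calc p.d * (p.Δ / (p.fth * p.δ)) = p.χ ^ 6 * (p.γ / p.Lmax) *
        (p.P₁ ^ 6 * p.P₂ ^ 2 * p.d * p.Lmax ^ 2 * p.Δ / (p.c ^ 5 * p.γ * p.ε ^ 2 * p.δ)) := by
        rw [fth]; field_simp
    _ = p.χ ^ 6 * (p.γ / p.Lmax) * Real.exp p.logFactor := by
        rw [hp.logFactor_eq, Real.exp_log (by positivity)]
    _ ≤ p.χ ^ 6 * (p.γ / p.Lmax) * Real.exp (p.χ * p.P₁) := by gcongr; exact hp.logFactor_le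

theorem sqrt_mul_lt_growth (hp : p.Admissible) (hΔ : 0 < p.Δ) {m : ℝ} (hm0 : 0 ≤ m)
    (hm : m ≤ 7 * (p.Δ / (p.fth * p.δ))) :
    16 * √⌈p.tth⌉₊ * (p.d * m) < (1 + p.η * p.γ / 2) ^ ⌈p.tth⌉₊ := by
  have hc := hp.c_pos; have hP₁ := hp.P₁_pos; have hLmax := hp.Lmax_pos; have hγ := hp.γ_pos
  have hχ := p.χ_pos; have htth := hp.tth_pos
  have hsqrt : √⌈p.tth⌉₊ ≤ 2 * p.tth := by
    refine le_trans (Real.sqrt_le_iff.2 ⟨by positivity, ?_⟩) hp.ceil_tth_le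
    exact le_self_pow₀ (by exact_mod_cast (by norm_num : 1 ≤ 16).trans hp.le_ceil_tth) two_ne_zero
  calc 16 * √⌈p.tth⌉₊ * (p.d * m)
      ≤ 16 * (2 * p.tth) * (p.d * (7 * (p.Δ / (p.fth * p.δ)))) := by gcongr
    _ = 224 * p.tth * (p.d * (p.Δ / (p.fth * p.δ))) := by ring
    _ ≤ 224 * p.tth * (p.χ ^ 6 * (p.γ / p.Lmax) * Real.exp (p.χ * p.P₁)) := by
        gcongr 224 * p.tth * ?_; exact hp.d_mul_gap_le hΔ
    _ = 224 / p.c ^ 2 * (p.χ ^ 7 * p.P₁) * Real.exp (p.χ * p.P₁) := by rw [tth]; field_simp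
    _ ≤ 224 / p.c ^ 2 * (p.χ * p.P₁) ^ 7 * Real.exp (p.χ * p.P₁) := by
        rw [mul_pow]
        gcongr
        exact le_self_pow₀ (by linarith [hp.two_le_P₁]) (by norm_num)
    _ < Real.exp (p.χ * p.P₁ / (4 * p.c)) :=
        pow_seven_mul_exp_lt_exp_div hc hp.c_le hp.le_χ_mul_P₁
    _ ≤ (1 + p.η * p.γ / 2) ^ ⌈p.tth⌉₊ := hp.exp_le_growth

theorem exists_translate_count (hp : p.Admissible) (hΔ : p.fth ≤ p.Δ) :
    ∃ m : ℕ, m ≠ 0 ∧ (m : ℝ) ≤ 7 * (p.Δ / (p.fth * p.δ)) ∧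
      3 / m * (p.Δ / p.fth + 1) ≤ p.δ := by
  have hf := hp.fth_pos; have hδ := hp.δ_pos
  have hΔ0 : 0 < p.Δ := hf.trans_le hΔ
  have hratio : 1 ≤ p.Δ / p.fth := (one_le_div hf).2 hΔ
  have hratioδ : 1 ≤ p.Δ / (p.fth * p.δ) := by
    rw [← div_div]; exact hratio.trans (le_div_self (by linarith) hδ hp.δ_le)
  refine ⟨⌈6 * (p.Δ / (p.fth * p.δ))⌉₊, (Nat.ceil_pos.2 (by positivity)).ne', ?_, ?_⟩
  · linarith [Nat.ceil_lt_add_one (by positivity : 0 ≤ 6 * (p.Δ / (p.fth * p.δ)))]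
  · calc 3 / (⌈6 * (p.Δ / (p.fth * p.δ))⌉₊ : ℝ) * (p.Δ / p.fth + 1)
        ≤ 3 / (6 * (p.Δ / (p.fth * p.δ))) * (p.Δ / p.fth + p.Δ / p.fth) := by
          gcongr; exact Nat.le_ceil _
      _ = p.δ := by field_simp; norm_num

theorem tth_mul_gap_eq (hp : p.Admissible) :
    p.tth * (p.Δ / p.fth) = 6 ^ 7 / p.c ^ 7 * (p.rate * max p.logFactor 4 ^ 7) := by
  have hc := hp.c_pos; have hε := hp.ε_pos; have hP₁ := hp.P₁_pos; have hP₂ := hp.P₂_pos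
  have hLmax := hp.Lmax_pos; have hγ := hp.γ_pos
  rw [hp.rate_eq, tth, fth, χ]
  field_simp

theorem iteration_bound_le (hp : p.Admissible) :
    (⌈p.tth⌉₊ + 1) * (p.Δ / p.fth + 1) ≤
      3 * 6 ^ 7 / p.c ^ 7 * (p.rate * max p.logFactor 4 ^ 7 + p.tth) := by
  have hc := hp.c_pos; have hf := hp.fth_pos; have htth := hp.tth_pos; have hΔ := hp.Δ_nonneg
  have hconst : 1 ≤ 6 ^ 7 / p.c ^ 7 := by
    rw [one_le_div (by positivity)]
    exact (pow_le_one₀ hc.le (by linarith [hp.c_le])).trans (by norm_num)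
  calc (⌈p.tth⌉₊ + 1) * (p.Δ / p.fth + 1) ≤ (2 * p.tth + p.tth) * (p.Δ / p.fth + 1) := by
        gcongr
        · exact hp.ceil_tth_le
        · linarith [hp.le_tth]
    _ = 3 * (p.tth * (p.Δ / p.fth)) + 3 * 1 * p.tth := by ring
    _ ≤ 3 * (p.tth * (p.Δ / p.fth)) + 3 * (6 ^ 7 / p.c ^ 7) * p.tth := by gcongr
    _ = 3 * 6 ^ 7 / p.c ^ 7 * (p.rate * max p.logFactor 4 ^ 7 + p.tth) := by
        rw [hp.tth_mul_gap_eq]; ring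

theorem four_le_logFactor (hp : p.Admissible) (hΔ : p.ε ^ 2 / p.Lmax ≤ p.Δ) :
    4 ≤ p.logFactor := by
  have hc := hp.c_pos; have hε := hp.ε_pos; have hP₁ := hp.P₁_pos; have hP₂ := hp.P₂_pos
  have hLmax := hp.Lmax_pos; have hγ := hp.γ_pos; have hδ := hp.δ_pos
  have hd : (1 : ℝ) ≤ p.d := by exact_mod_cast hp.d_pos
  have hΔ0 : 0 < p.Δ := lt_of_lt_of_le (by positivity) hΔ
  have hc5 : p.c ^ 5 ≤ 1 / 100 :=
    (pow_le_pow_left₀ hc.le hp.c_le 5).trans (by norm_num)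
  have hexp : Real.exp 4 ≤ 100 :=
    calc Real.exp 4 = Real.exp 1 ^ 4 := by rw [← Real.exp_nat_mul]; norm_num
      _ ≤ 2.72 ^ 4 := by gcongr; linarith [Real.exp_one_lt_d9]
      _ ≤ 100 := by norm_num
  rw [hp.logFactor_eq, Real.le_log_iff_exp_le (by positivity)]
  calc Real.exp 4 ≤ 100 := hexp
    _ = 1 ^ 6 * 1 ^ 2 * 1 * p.Lmax ^ 2 * (p.ε ^ 2 / p.Lmax) /
        (1 / 100 * p.Lmax * p.ε ^ 2 * 1) := by field_simp
    _ ≤ _ := by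
      gcongr
      · linarith [hp.two_le_P₁]
      · exact hp.one_le_P₂
      · exact hp.γ_le
      · exact hp.δ_le

theorem Lmax_mul_P₁_div_γ_le_rate (hp : p.Admissible) (hΔ : p.ε ^ 2 / p.Lmax ≤ p.Δ) :
    p.Lmax * p.P₁ / p.γ ≤ p.rate := by
  have hε := hp.ε_pos; have hP₁ := hp.P₁_pos; have hLmax := hp.Lmax_pos; have hγ := hp.γ_pos
  calc p.Lmax * p.P₁ / p.γ = p.Lmax ^ 2 * p.P₁ * 1 ^ 2 * (p.ε ^ 2 / p.Lmax) /
        (p.γ * p.ε ^ 2) := by field_simp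
    _ ≤ p.Lmax ^ 2 * p.P₁ ^ 7 * p.P₂ ^ 2 * p.Δ / (p.γ * p.ε ^ 2) := by
        gcongr
        · exact le_self_pow₀ (by linarith [hp.two_le_P₁]) (by norm_num)
        · exact hp.one_le_P₂
    _ = p.rate := hp.rate_eq.symm

theorem tth_le_of_le_Δ (hp : p.Admissible) (hΔ : p.ε ^ 2 / p.Lmax ≤ p.Δ) :
    p.tth ≤ 6 / p.c ^ 2 * (p.rate * p.logFactor ^ 7) := by
  have hc := hp.c_pos; have hP₁ := hp.P₁_pos; have hLmax := hp.Lmax_pos; have hγ := hp.γ_pos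
  have hlog := hp.four_le_logFactor hΔ
  have hrate := hp.Lmax_mul_P₁_div_γ_le_rate hΔ
  have hrate0 := hp.rate_nonneg
  calc p.tth = 6 / p.c ^ 2 * (p.Lmax * p.P₁ / p.γ * p.logFactor) := by
        rw [tth, χ, max_eq_left hlog]; field_simp
    _ ≤ 6 / p.c ^ 2 * (p.rate * p.logFactor ^ 7) := by
        gcongr
        exact le_self_pow₀ (by linarith) (by norm_num)

theorem le_iterationConst_mul_rate_add_tth (hp : p.Admissible) {T : ℝ}
    (hT : T ≤ (⌈p.tth⌉₊ + 1) * (p.Δ / p.fth + 1)) :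
    T ≤ iterationConst p.c * (p.rate * max p.logFactor 4 ^ 7 + p.tth) := by
  have hc := hp.c_pos; have htth := hp.tth_pos; have hrate := hp.rate_nonneg
  refine (hT.trans hp.iteration_bound_le).trans ?_
  gcongr
  exact le_mul_of_one_le_right (by positivity) (le_add_of_nonneg_right (by positivity))

theorem le_iterationConst_mul_rate (hp : p.Admissible) (hΔ : p.ε ^ 2 / p.Lmax ≤ p.Δ) {T : ℝ}
    (hT : T ≤ (⌈p.tth⌉₊ + 1) * (p.Δ / p.fth + 1)) :
    T ≤ iterationConst p.c * (p.rate * p.logFactor ^ 7) := by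
  have hc := hp.c_pos
  calc T ≤ 3 * 6 ^ 7 / p.c ^ 7 * (p.rate * p.logFactor ^ 7 + p.tth) :=
        max_eq_left (hp.four_le_logFactor hΔ) ▸ hT.trans hp.iteration_bound_le
    _ ≤ 3 * 6 ^ 7 / p.c ^ 7 *
        (p.rate * p.logFactor ^ 7 + 6 / p.c ^ 2 * (p.rate * p.logFactor ^ 7)) := by
        gcongr
        exact hp.tth_le_of_le_Δ hΔ
    _ = iterationConst p.c * (p.rate * p.logFactor ^ 7) := by rw [iterationConst]; ring

end Admissible

end PAGDParams

/-! ### The stuck set at a saddle point -/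

section Continuity

variable {d : ℕ} {blk : Fin d → Fin 2} {f : EuclideanSpace ℝ (Fin d) → ℝ}

theorem continuous_blockGrad (hg : Continuous (gradient f)) (k : Fin 2) :
    Continuous (blockGrad blk f k) :=
  (blockProj blk k).continuous.comp hg

theorem continuous_agdHalf (hg : Continuous (gradient f)) (η : ℝ) :
    Continuous (agdHalf blk f η) :=
  continuous_id.sub ((continuous_blockGrad hg 0).const_smul η)

theorem continuous_agdStep (hg : Continuous (gradient f)) (η : ℝ) :
    Continuous (agdStep blk f η) :=
  (continuous_agdHalf hg η).sub
    (((continuous_blockGrad hg 1).comp (continuous_agdHalf hg η)).const_smul η)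

theorem continuous_agdGradSq (hg : Continuous (gradient f)) (η : ℝ) :
    Continuous (agdGradSq blk f η) :=
  ((continuous_blockGrad hg 0).norm.pow 2).add
    (((continuous_blockGrad hg 1).comp (continuous_agdHalf hg η)).norm.pow 2)

/-- The pairs of a point `x` and a noise `y` for which the alternating gradient steps from `x + y`
do not bring the objective down to `f x - f_th` within the time threshold. -/
def stuckPairs (p : PAGDParams) (blk : Fin d → Fin 2) (f : EuclideanSpace ℝ (Fin d) → ℝ) :
    Set (EuclideanSpace ℝ (Fin d) × EuclideanSpace ℝ (Fin d)) :=
  {a | -p.fth < f ((agdStep blk f p.η)^[⌈p.tth⌉₊] (a.1 + a.2)) - f a.1}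

theorem measurableSet_stuckPairs (p : PAGDParams) (hf : Continuous f)
    (hg : Continuous (gradient f)) : MeasurableSet (stuckPairs p blk f) := by
  have hiter := (continuous_agdStep (blk := blk) hg p.η).iterate ⌈p.tth⌉₊
  exact (isOpen_lt continuous_const (by fun_prop)).measurableSet

end Continuity

section Saddle

variable {d : ℕ} {blk : Fin d → Fin 2} {f : EuclideanSpace ℝ (Fin d) → ℝ} {Lb Lt : Fin 2 → ℝ}
  {p : PAGDParams} {x v : EuclideanSpace ℝ (Fin d)}

theorem uniformBall_preimage_stuckPairs_le (hp : p.Admissible) (hd : p.d = d)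
    (hLmax : p.Lmax = blockLmax Lb Lt) (h : IsBlockSmooth blk f Lb Lt)
    (hH : IsHessianLipschitz f p.ρ) (hΔ : 0 < p.Δ) {m : ℕ} (hm : m ≠ 0)
    (hmΔ : m ≤ 7 * (p.Δ / (p.fth * p.δ))) (hx : agdGradSq blk f p.η x ≤ p.gth ^ 2)
    (hv : ‖v‖ = 1) (hvH : ⟪v, hessian f x v⟫ ≤ -p.γ) :
    uniformBall d p.r (Prod.mk x ⁻¹' stuckPairs p blk f) ≤ ENNReal.ofReal (3 / m) := by
  have hdm : (0 : ℝ) < d * m := by have := hp.d_pos; subst hd; positivity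
  obtain ⟨φ, hφ, hescape⟩ := exists_escape_direction h (hLmax ▸ hp.Lmax_pos.le) hH hp.ρ_pos.le
    hp.η_pos (hLmax ▸ hp.η_mul_Lmax_le) hp.gth_pos.le hp.le_ceil_tth
    (hLmax ▸ hp.linearization_error_le) hx hp.γ_pos.le hv hvH
  have hstuck : ∀ y ∈ Metric.ball 0 p.r ∩ Prod.mk x ⁻¹' stuckPairs p blk f,
      IsStuck blk f p.η p.gth ⌈p.tth⌉₊ x (x + y) := fun y ⟨hyr, hy⟩ =>
    ⟨by simpa [hp.r_eq] using (mem_ball_zero_iff.1 hyr).le, hp.fth_eq ▸ hy⟩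
  refine uniformBall_le_of_isThinAlong hp.r_pos hm (measurable_prodMk_left
    (measurableSet_stuckPairs p h.1.continuous hH.2.1.continuous)) hφ fun u s hs hu hus => ?_
  have hgrowth : 0 < 1 + p.η * p.γ / 2 := by
    have := hp.γ_pos
    have := hp.η_pos
    positivity
  refine lt_of_mul_lt_mul_left (a := (1 + p.η * p.γ / 2) ^ ⌈p.tth⌉₊) ?_ (by positivity)
  calc (1 + p.η * p.γ / 2) ^ ⌈p.tth⌉₊ * s ≤ 16 * √⌈p.tth⌉₊ * (p.η * p.gth) :=
        hescape (x + u) s hs (hstuck u hu) (add_assoc x u _ ▸ hstuck _ hus)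
    _ = 16 * √⌈p.tth⌉₊ * (d * m) * (p.r / (d * m)) := by
        rw [← hp.r_eq, mul_assoc _ (d * m : ℝ), mul_div_cancel₀ _ hdm.ne']
    _ < (1 + p.η * p.γ / 2) ^ ⌈p.tth⌉₊ * (p.r / (d * m)) := by
        have := hp.r_pos
        gcongr
        exact hd ▸ hp.sqrt_mul_lt_growth hΔ m.cast_nonneg hmΔ

theorem fth_le_sub_of_curvature_le (hp : p.Admissible) (hH : IsHessianLipschitz f p.ρ)
    {fstar : ℝ} (hfstar : ∀ y, fstar ≤ f y) (hv : ‖v‖ = 1) (hvH : ⟪v, hessian f x v⟫ ≤ -p.γ) :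
    p.fth ≤ f x - fstar := by
  have hρ := hp.ρ_pos
  have hLmax := hp.Lmax_pos
  have hε := hp.ε_pos
  obtain ⟨y, hy⟩ := hH.exists_le_sub_of_curvature_le hρ hp.γ_pos.le hv hvH
  have hερ : p.ε * p.ρ ≤ p.Lmax ^ 2 := (le_div_iff₀ hρ).1 hp.ε_le
  calc p.fth ≤ p.ε ^ 2 / (16 * p.Lmax) := hp.fth_le
    _ = p.ε * (p.ε * p.ρ) / (16 * p.Lmax * p.ρ) := by field_simp
    _ ≤ p.ε * p.Lmax ^ 2 / (16 * p.Lmax * p.ρ) := by gcongr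
    _ = p.γ ^ 3 / (16 * p.ρ ^ 2) := by rw [hp.γ_cube]; field_simp
    _ ≤ f x - fstar := by linarith [hfstar y]

end Saddle

/-! ### The run of the algorithm -/

section Run

variable {d : ℕ} {p : PAGDParams} {blk : Fin d → Fin 2} {f : EuclideanSpace ℝ (Fin d) → ℝ}
  {x₀ x y : EuclideanSpace ℝ (Fin d)} {ξ : ℕ → EuclideanSpace ℝ (Fin d)} {t : ℕ}
  {s s' : PAGDState d}

/-- More than the time threshold has passed at time `t` since the last perturbation recorded in `s`
(or there was none). -/
def PAGDState.IsIdle (s : PAGDState d) (p : PAGDParams) (t : ℕ) : Prop :=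
  ∀ q ∈ s.last, q.1 + ⌈p.tth⌉₊ < t

theorem pagdIter_of_perturb (htth : ⌈p.tth⌉₊ ≠ 0) (hs : s.IsIdle p t)
    (hx : agdGradSq blk f p.η s.x ≤ p.gth ^ 2) (y : EuclideanSpace ℝ (Fin d)) :
    pagdIter p blk f t y s = Sum.inl ⟨agdStep blk f p.η (s.x + y), some (t, s.x)⟩ := by
  have hpert : pagdPerturb p blk f t y s = ⟨s.x + y, some (t, s.x)⟩ := if_pos ⟨hx, hs⟩
  simp [pagdIter, hpert, htth]

theorem pagdIter_of_return {tp : ℕ} {xt : EuclideanSpace ℝ (Fin d)} (ht : t = tp + ⌈p.tth⌉₊)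
    (hx : -p.fth < f x - f xt) (y : EuclideanSpace ℝ (Fin d)) :
    pagdIter p blk f t y ⟨x, some (tp, xt)⟩ = Sum.inr xt := by
  have hpert : pagdPerturb p blk f t y ⟨x, some (tp, xt)⟩ = ⟨x, some (tp, xt)⟩ :=
    if_neg fun h => by simpa [ht] using h.2 (tp, xt) rfl
  simp only [pagdIter, hpert]
  exact if_pos ⟨ht, hx⟩

theorem pagdIter_of_step (hpert : ¬(agdGradSq blk f p.η s.x ≤ p.gth ^ 2 ∧ s.IsIdle p t))
    (htest : ∀ q ∈ s.last, t = q.1 + ⌈p.tth⌉₊ → f s.x - f q.2 ≤ -p.fth)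
    (y : EuclideanSpace ℝ (Fin d)) :
    pagdIter p blk f t y s = Sum.inl ⟨agdStep blk f p.η s.x, s.last⟩ := by
  have hs : pagdPerturb p blk f t y s = s := if_neg hpert
  obtain ⟨x, _ | ⟨tp, xt⟩⟩ := s
  · simp [pagdIter, hs]
  · simp only [pagdIter, hs]
    exact if_neg fun h => (htest (tp, xt) rfl h.1).not_gt h.2

theorem pagdRun_succ_of_inl (hs : pagdRun p blk f x₀ ξ t = Sum.inl s) :
    pagdRun p blk f x₀ ξ (t + 1) = pagdIter p blk f t (ξ t) s := by
  rw [pagdRun, hs]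

theorem exists_of_pagdRun_succ_eq_inl (hs' : pagdRun p blk f x₀ ξ (t + 1) = Sum.inl s') :
    ∃ s, pagdRun p blk f x₀ ξ t = Sum.inl s ∧ pagdIter p blk f t (ξ t) s = Sum.inl s' := by
  rw [pagdRun] at hs'
  cases hr : pagdRun p blk f x₀ ξ t with
  | inl s => exact ⟨s, rfl, by rwa [hr] at hs'⟩
  | inr y => simp [hr] at hs'

/-- The run perturbs the iterate `x` in iteration `t`. -/
def PerturbsAt (p : PAGDParams) (blk : Fin d → Fin 2) (f : EuclideanSpace ℝ (Fin d) → ℝ)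
    (x₀ : EuclideanSpace ℝ (Fin d)) (ξ : ℕ → EuclideanSpace ℝ (Fin d)) (t : ℕ)
    (x : EuclideanSpace ℝ (Fin d)) : Prop :=
  agdGradSq blk f p.η x ≤ p.gth ^ 2 ∧
    ∃ s, pagdRun p blk f x₀ ξ t = Sum.inl s ∧ s.IsIdle p t ∧ s.x = x

open Classical in
/-- The number of perturbations before iteration `t`. -/
noncomputable def perturbCount (p : PAGDParams) (blk : Fin d → Fin 2)
    (f : EuclideanSpace ℝ (Fin d) → ℝ) (x₀ : EuclideanSpace ℝ (Fin d))
    (ξ : ℕ → EuclideanSpace ℝ (Fin d)) (t : ℕ) : ℕ :=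
  Nat.count (fun i => ∃ x, PerturbsAt p blk f x₀ ξ i x) t

open Classical in
theorem perturbCount_succ_of_perturbsAt (hx : PerturbsAt p blk f x₀ ξ t x) :
    perturbCount p blk f x₀ ξ (t + 1) = perturbCount p blk f x₀ ξ t + 1 :=
  Nat.count_succ_eq_succ_count ⟨x, hx⟩

open Classical in
theorem perturbCount_succ_of_not (h : ¬∃ x, PerturbsAt p blk f x₀ ξ t x) :
    perturbCount p blk f x₀ ξ (t + 1) = perturbCount p blk f x₀ ξ t :=
  Nat.count_succ_eq_count h

theorem not_exists_perturbsAt (hs : pagdRun p blk f x₀ ξ t = Sum.inl s)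
    (hpert : ¬(agdGradSq blk f p.η s.x ≤ p.gth ^ 2 ∧ s.IsIdle p t)) :
    ¬∃ x, PerturbsAt p blk f x₀ ξ t x := by
  rintro ⟨x, hx, s', hs', hidle, rfl⟩
  obtain rfl : s = s' := Sum.inl.inj (hs.symm.trans hs')
  exact hpert ⟨hx, hidle⟩

/-- The decrease of the objective per iteration, on average, that the analysis establishes. -/
noncomputable def PAGDParams.pace (p : PAGDParams) : ℝ := p.fth / (⌈p.tth⌉₊ + 1)

theorem PAGDParams.pace_mul (p : PAGDParams) : p.pace * (⌈p.tth⌉₊ + 1) = p.fth :=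
  div_mul_cancel₀ _ (by positivity)

/-- The progress of a run that is in state `s` before iteration `t`: either it is idle, or it is
following the trajectory of its last perturbation. -/
inductive RunPhase (p : PAGDParams) (blk : Fin d → Fin 2) (f : EuclideanSpace ℝ (Fin d) → ℝ)
    (x₀ : EuclideanSpace ℝ (Fin d)) (ξ : ℕ → EuclideanSpace ℝ (Fin d)) (t : ℕ) :
    PAGDState d → Prop
  | idle {s : PAGDState d} (hidle : s.IsIdle p t)
      (hcount : perturbCount p blk f x₀ ξ t * (⌈p.tth⌉₊ + 1) ≤ t)
      (hdecr : f s.x ≤ f x₀ - p.pace * t) : RunPhase p blk f x₀ ξ t s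
  | pending {tp : ℕ} {x xt : EuclideanSpace ℝ (Fin d)} (hpert : PerturbsAt p blk f x₀ ξ tp xt)
      (hle : tp ≤ t) (ht : t ≤ tp + ⌈p.tth⌉₊)
      (hx : x = (agdStep blk f p.η)^[t - tp] (xt + ξ tp))
      (hcount : perturbCount p blk f x₀ ξ t * (⌈p.tth⌉₊ + 1) ≤ tp + (⌈p.tth⌉₊ + 1))
      (hdecr : f xt ≤ f x₀ - p.pace * tp) :
      RunPhase p blk f x₀ ξ t ⟨x, some (tp, xt)⟩

/-- The properties of the parameters and the objective on which the progress of a run rests. -/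
structure RunRegular (p : PAGDParams) (blk : Fin d → Fin 2)
    (f : EuclideanSpace ℝ (Fin d) → ℝ) : Prop where
  fth_pos : 0 < p.fth
  ceil_tth_ne_zero : ⌈p.tth⌉₊ ≠ 0
  agdStep_le : ∀ x, f (agdStep blk f p.η x) ≤ f x
  agdStep_le_sub_pace : ∀ x, p.gth ^ 2 < agdGradSq blk f p.η x →
    f (agdStep blk f p.η x) ≤ f x - p.pace

/-- After `T` iterations, the run has returned a point that it had perturbed before and whose
perturbation was stuck. -/
def ReturnsStuck (p : PAGDParams) (blk : Fin d → Fin 2) (f : EuclideanSpace ℝ (Fin d) → ℝ)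
    (x₀ : EuclideanSpace ℝ (Fin d)) (ξ : ℕ → EuclideanSpace ℝ (Fin d)) (T : ℕ) : Prop :=
  ∃ tp x, pagdRun p blk f x₀ ξ T = Sum.inr x ∧ PerturbsAt p blk f x₀ ξ tp x ∧
    (x, ξ tp) ∈ stuckPairs p blk f

namespace RunRegular

theorem idle_or_pending_succ_of_idle (hR : RunRegular p blk f)
    (hs : pagdRun p blk f x₀ ξ t = Sum.inl s) (hidle : s.IsIdle p t)
    (hcount : perturbCount p blk f x₀ ξ t * (⌈p.tth⌉₊ + 1) ≤ t)
    (hdecr : f s.x ≤ f x₀ - p.pace * t) :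
    ∃ s', pagdRun p blk f x₀ ξ (t + 1) = Sum.inl s' ∧ RunPhase p blk f x₀ ξ (t + 1) s' := by
  rw [pagdRun_succ_of_inl hs]
  by_cases hx : agdGradSq blk f p.η s.x ≤ p.gth ^ 2
  · have hpert : PerturbsAt p blk f x₀ ξ t s.x := ⟨hx, s, hs, hidle, rfl⟩
    refine ⟨_, pagdIter_of_perturb hR.ceil_tth_ne_zero hidle hx _, .pending hpert t.le_succ
      (Nat.add_le_add_left (Nat.one_le_iff_ne_zero.2 hR.ceil_tth_ne_zero) t) (by simp) ?_ hdecr⟩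
    rw [perturbCount_succ_of_perturbsAt hpert, Nat.succ_mul]
    gcongr
  · refine ⟨_, pagdIter_of_step (fun h => hx h.1) (fun q hq ht => ?_) _, .idle ?_ ?_ ?_⟩
    · exact absurd ht (hidle q hq).ne'
    · exact fun q hq => (hidle q hq).trans t.lt_succ_self
    · rw [perturbCount_succ_of_not (not_exists_perturbsAt hs fun h => hx h.1)]
      exact hcount.trans t.le_succ
    · push_cast
      linarith [hR.agdStep_le_sub_pace _ (not_le.1 hx)]

theorem returnsStuck_or_succ_of_pending (hR : RunRegular p blk f) {tp : ℕ}
    {xt : EuclideanSpace ℝ (Fin d)}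
    (hs : pagdRun p blk f x₀ ξ t = Sum.inl ⟨x, some (tp, xt)⟩)
    (hpert : PerturbsAt p blk f x₀ ξ tp xt) (hle : tp ≤ t) (ht : t ≤ tp + ⌈p.tth⌉₊)
    (hx : x = (agdStep blk f p.η)^[t - tp] (xt + ξ tp))
    (hcount : perturbCount p blk f x₀ ξ t * (⌈p.tth⌉₊ + 1) ≤ tp + (⌈p.tth⌉₊ + 1))
    (hdecr : f xt ≤ f x₀ - p.pace * tp) :
    ReturnsStuck p blk f x₀ ξ (t + 1) ∨
      ∃ s', pagdRun p blk f x₀ ξ (t + 1) = Sum.inl s' ∧ RunPhase p blk f x₀ ξ (t + 1) s' := by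
  have hnot : ¬(agdGradSq blk f p.η x ≤ p.gth ^ 2 ∧
      PAGDState.IsIdle ⟨x, some (tp, xt)⟩ p t) := fun h => (h.2 (tp, xt) rfl).not_ge ht
  have hcount' := perturbCount_succ_of_not (not_exists_perturbsAt hs hnot)
  have hstep (htest : t = tp + ⌈p.tth⌉₊ → f x - f xt ≤ -p.fth) :
      pagdRun p blk f x₀ ξ (t + 1) = Sum.inl ⟨agdStep blk f p.η x, some (tp, xt)⟩ :=
    (pagdRun_succ_of_inl hs).trans <| pagdIter_of_step (s := ⟨x, some (tp, xt)⟩) hnot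
      (by simpa only [Option.mem_some_iff, forall_eq'] using htest) (ξ t)
  rcases ht.lt_or_eq with hlt | heq
  · have hx' : agdStep blk f p.η x = (agdStep blk f p.η)^[t + 1 - tp] (xt + ξ tp) := by
      rw [hx, Nat.succ_sub hle, Function.iterate_succ_apply']
    exact Or.inr ⟨_, hstep fun h => absurd h hlt.ne, .pending hpert (hle.trans t.le_succ)
      (Nat.succ_le_of_lt hlt) hx' (by rwa [hcount']) hdecr⟩
  have hKx : (agdStep blk f p.η)^[⌈p.tth⌉₊] (xt + ξ tp) = x := by
    rw [hx, heq, Nat.add_sub_cancel_left]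
  by_cases hstuck : -p.fth < f x - f xt
  · exact Or.inl ⟨tp, xt, (pagdRun_succ_of_inl hs).trans (pagdIter_of_return heq hstuck _),
      hpert, by simpa only [stuckPairs, Set.mem_ofPred_eq, hKx] using hstuck⟩
  · have hdrop := not_lt.1 hstuck
    have hidle : PAGDState.IsIdle ⟨agdStep blk f p.η x, some (tp, xt)⟩ p (t + 1) := by
      simp only [PAGDState.IsIdle, Option.mem_some_iff, forall_eq']
      exact heq.symm.trans_lt t.lt_succ_self
    refine Or.inr ⟨_, hstep fun _ => hdrop, .idle hidle ?_ ?_⟩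
    · rw [hcount']
      exact hcount.trans_eq (by rw [heq, add_assoc])
    · rw [heq]
      push_cast
      linarith [hR.agdStep_le x, p.pace_mul]

theorem returnsStuck_or_succ (hR : RunRegular p blk f)
    (hs : pagdRun p blk f x₀ ξ t = Sum.inl s) (hphase : RunPhase p blk f x₀ ξ t s) :
    ReturnsStuck p blk f x₀ ξ (t + 1) ∨
      ∃ s', pagdRun p blk f x₀ ξ (t + 1) = Sum.inl s' ∧ RunPhase p blk f x₀ ξ (t + 1) s' := by
  cases hphase with
  | idle hidle hcount hdecr =>
    exact Or.inr (hR.idle_or_pending_succ_of_idle hs hidle hcount hdecr)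
  | pending hpert hle ht hx hcount hdecr =>
    exact hR.returnsStuck_or_succ_of_pending hs hpert hle ht hx hcount hdecr

theorem runPhase (hR : RunRegular p blk f) (hs : pagdRun p blk f x₀ ξ t = Sum.inl s) :
    RunPhase p blk f x₀ ξ t s := by
  induction t generalizing s with
  | zero =>
    obtain rfl := Sum.inl.inj hs
    exact .idle (by simp [PAGDState.IsIdle]) (by simp [perturbCount]) (by simp)
  | succ t ih =>
    obtain ⟨s₁, hs₁, -⟩ := exists_of_pagdRun_succ_eq_inl hs
    rcases hR.returnsStuck_or_succ hs₁ (ih hs₁) with ⟨-, y, hy, -⟩ | ⟨s', hs', hphase⟩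
    · simp [hs] at hy
    · rwa [Sum.inl.inj (hs.symm.trans hs')]

theorem perturbCount_mul_le_of_perturbsAt (hR : RunRegular p blk f)
    (hx : PerturbsAt p blk f x₀ ξ t x) :
    perturbCount p blk f x₀ ξ t * (⌈p.tth⌉₊ + 1) ≤ t ∧ f x ≤ f x₀ - p.pace * t := by
  obtain ⟨-, s, hs, hidle, rfl⟩ := hx
  cases hR.runPhase hs with
  | idle _ hcount hdecr => exact ⟨hcount, hdecr⟩
  | pending _ _ ht => exact absurd (hidle _ rfl) ht.not_gt

theorem natCast_le_of_apply_le (hR : RunRegular p blk f) {fstar : ℝ} (hfstar : ∀ y, fstar ≤ f y)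
    (hx : f x ≤ f x₀ - p.pace * t) :
    (t : ℝ) ≤ (⌈p.tth⌉₊ + 1) * ((f x₀ - fstar) / p.fth) := by
  have hf := hR.fth_pos
  rw [mul_div_assoc', le_div_iff₀ hf]
  calc t * p.fth = (⌈p.tth⌉₊ + 1) * (p.pace * t) := by rw [← p.pace_mul]; ring
    _ ≤ (⌈p.tth⌉₊ + 1) * (f x₀ - fstar) := by gcongr; linarith [hfstar x]

theorem perturbCount_le (hR : RunRegular p blk f) {fstar : ℝ} (hfstar : ∀ y, fstar ≤ f y)
    (t : ℕ) : (perturbCount p blk f x₀ ξ t : ℝ) ≤ (f x₀ - fstar) / p.fth + 1 := by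
  induction t with
  | zero =>
    have := div_nonneg (sub_nonneg.2 (hfstar x₀)) hR.fth_pos.le
    simp only [perturbCount, Nat.count_zero, Nat.cast_zero]
    linarith
  | succ t ih =>
    by_cases h : ∃ x, PerturbsAt p blk f x₀ ξ t x
    · obtain ⟨x, hx⟩ := h
      obtain ⟨hcount, hdecr⟩ := hR.perturbCount_mul_le_of_perturbsAt hx
      have hcount' : (perturbCount p blk f x₀ ξ t : ℝ) * (⌈p.tth⌉₊ + 1) ≤ t := by
        exact_mod_cast hcount
      rw [perturbCount_succ_of_perturbsAt hx]
      push_cast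
      gcongr
      refine le_of_mul_le_mul_right ?_ (by positivity : (0 : ℝ) < ⌈p.tth⌉₊ + 1)
      exact (hcount'.trans (hR.natCast_le_of_apply_le hfstar hdecr)).trans_eq (mul_comm _ _)
    · rwa [perturbCount_succ_of_not h]

theorem succ_le_of_pagdRun_eq_inl (hR : RunRegular p blk f) {fstar : ℝ}
    (hfstar : ∀ y, fstar ≤ f y) (hs : pagdRun p blk f x₀ ξ t = Sum.inl s) :
    (t : ℝ) + 1 ≤ (⌈p.tth⌉₊ + 1) * ((f x₀ - fstar) / p.fth + 1) := by
  rw [mul_add_one]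
  cases hR.runPhase hs with
  | idle _ _ hdecr =>
    linarith [hR.natCast_le_of_apply_le hfstar hdecr, Nat.cast_nonneg (α := ℝ) ⌈p.tth⌉₊]
  | @pending tp _ _ _ _ ht _ _ hdecr =>
    have ht' : (t : ℝ) ≤ tp + ⌈p.tth⌉₊ := by exact_mod_cast ht
    linarith [hR.natCast_le_of_apply_le hfstar hdecr]

theorem exists_returnsStuck (hR : RunRegular p blk f) {fstar : ℝ} (hfstar : ∀ y, fstar ≤ f y)
    (x₀ : EuclideanSpace ℝ (Fin d)) (ξ : ℕ → EuclideanSpace ℝ (Fin d)) :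
    ∃ T : ℕ, (T : ℝ) ≤ (⌈p.tth⌉₊ + 1) * ((f x₀ - fstar) / p.fth + 1) ∧
      ReturnsStuck p blk f x₀ ξ T := by
  by_contra! hno
  have hrun : ∀ t, ∃ s, pagdRun p blk f x₀ ξ t = Sum.inl s := fun t => by
    induction t with
    | zero => exact ⟨_, rfl⟩
    | succ t ih =>
      obtain ⟨s, hs⟩ := ih
      rcases hR.returnsStuck_or_succ hs (hR.runPhase hs) with hT | ⟨s', hs', -⟩
      · exact absurd hT (hno _ (by exact_mod_cast hR.succ_le_of_pagdRun_eq_inl hfstar hs))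
      · exact ⟨s', hs'⟩
  obtain ⟨s, hs⟩ := hrun ⌊(⌈p.tth⌉₊ + 1) * ((f x₀ - fstar) / p.fth + 1)⌋₊
  exact (hR.succ_le_of_pagdRun_eq_inl hfstar hs).not_gt (Nat.lt_floor_add_one _)

end RunRegular

end Run

/-! ### The probability of a stuck perturbation -/

section Measure

variable {Ω S E : Type*} [MeasurableSpace Ω] [MeasurableSpace S] [MeasurableSpace E]
  {P : Measure Ω}

theorem measure_mem_and_mem_le_of_indepFun [IsFiniteMeasure P] {Y : Ω → S} {X : Ω → E}
    (hY : Measurable Y) (hX : Measurable X) (hind : IndepFun Y X P) {D : Set S}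
    (hD : MeasurableSet D) {B : Set (S × E)} (hB : MeasurableSet B) {c : ENNReal}
    (h : ∀ s ∈ D, P.map X (Prod.mk s ⁻¹' B) ≤ c) :
    P {ω | Y ω ∈ D ∧ (Y ω, X ω) ∈ B} ≤ c * P {ω | Y ω ∈ D} := by
  have hDB : MeasurableSet (Prod.fst ⁻¹' D ∩ B) := (measurable_fst hD).inter hB
  calc P {ω | Y ω ∈ D ∧ (Y ω, X ω) ∈ B}
      = (P.map fun ω => (Y ω, X ω)) (Prod.fst ⁻¹' D ∩ B) :=
        (Measure.map_apply (hY.prodMk hX) hDB).symm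
    _ = ∫⁻ s, P.map X (Prod.mk s ⁻¹' (Prod.fst ⁻¹' D ∩ B)) ∂(P.map Y) := by
        rw [(indepFun_iff_map_prod_eq_prod_map_map hY.aemeasurable hX.aemeasurable).1 hind,
          Measure.prod_apply hDB]
    _ ≤ ∫⁻ s, D.indicator (fun _ => c) s ∂(P.map Y) := by
        refine lintegral_mono fun s => ?_
        by_cases hs : s ∈ D
        · rw [Set.indicator_of_mem hs]
          exact (measure_mono fun y hy => hy.2).trans (h s hs)
        · rw [Set.preimage_inter, Set.preimage_preimage, Set.preimage_const_of_notMem hs]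
          simp
    _ = c * P {ω | Y ω ∈ D} := by
        rw [lintegral_indicator_const hD, Measure.map_apply hY hD, Set.preimage]

theorem tsum_measure_le_of_count_le {q : ℕ → Ω → Prop} [∀ ω, DecidablePred (q · ω)]
    (hq : ∀ t, MeasurableSet {ω | q t ω}) {M : ENNReal}
    (hM : ∀ ω n, (Nat.count (q · ω) n : ENNReal) ≤ M) :
    ∑' t, P {ω | q t ω} ≤ M * P Set.univ := by
  calc ∑' t, P {ω | q t ω} = ∫⁻ ω, ∑' t, {ω | q t ω}.indicator 1 ω ∂P := by
        rw [lintegral_tsum fun t => (measurable_one.indicator (hq t)).aemeasurable]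
        simp only [lintegral_indicator_one (hq _)]
    _ ≤ ∫⁻ _, M ∂P := by
        refine lintegral_mono fun ω => ENNReal.tsum_le_of_sum_range_le fun n => ?_
        refine le_of_eq_of_le ?_ (hM ω n)
        simp [Nat.count_eq_card_filter_range, Set.indicator_apply]
    _ = M * P Set.univ := lintegral_const M

end Measure

section Code

variable {d : ℕ} {p : PAGDParams} {blk : Fin d → Fin 2} {f : EuclideanSpace ℝ (Fin d) → ℝ}
  {x₀ x : EuclideanSpace ℝ (Fin d)} {t : ℕ} {s : PAGDState d}

/-- The outcomes of a run, encoded in a measurable space: the middle component is `0` before the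
first perturbation, `1` after the return and `tp + 2` if the last perturbation was at `tp`. -/
def runCode : PAGDState d ⊕ EuclideanSpace ℝ (Fin d) →
    EuclideanSpace ℝ (Fin d) × ℕ × EuclideanSpace ℝ (Fin d)
  | Sum.inl ⟨x, none⟩ => (x, 0, 0)
  | Sum.inl ⟨x, some (tp, xt)⟩ => (x, tp + 2, xt)
  | Sum.inr y => (0, 1, y)

/-- The codes of the states that are perturbed in iteration `t`. -/
def perturbCodes (p : PAGDParams) (blk : Fin d → Fin 2) (f : EuclideanSpace ℝ (Fin d) → ℝ)
    (t : ℕ) : Set (EuclideanSpace ℝ (Fin d) × ℕ × EuclideanSpace ℝ (Fin d)) :=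
  {c | agdGradSq blk f p.η c.1 ≤ p.gth ^ 2} ∩
    (·.2.1) ⁻¹' {n | n = 0 ∨ 2 ≤ n ∧ n + ⌈p.tth⌉₊ < t + 2}

/-- The codes of the states in which iteration `t` returns. -/
def returnCodes (p : PAGDParams) (f : EuclideanSpace ℝ (Fin d) → ℝ) (t : ℕ) :
    Set (EuclideanSpace ℝ (Fin d) × ℕ × EuclideanSpace ℝ (Fin d)) :=
  {c | -p.fth < f c.1 - f c.2.2} ∩ (·.2.1) ⁻¹' {n | 2 ≤ n ∧ t + 2 = n + ⌈p.tth⌉₊}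

open Classical in
/-- Iteration `t` on the level of codes, with the noise as the second component of the argument. -/
noncomputable def iterCode (p : PAGDParams) (blk : Fin d → Fin 2)
    (f : EuclideanSpace ℝ (Fin d) → ℝ) (t : ℕ)
    (a : (EuclideanSpace ℝ (Fin d) × ℕ × EuclideanSpace ℝ (Fin d)) × EuclideanSpace ℝ (Fin d)) :
    EuclideanSpace ℝ (Fin d) × ℕ × EuclideanSpace ℝ (Fin d) :=
  if a.1.2.1 = 1 then a.1
  else if a.1 ∈ perturbCodes p blk f t then (agdStep blk f p.η (a.1.1 + a.2), t + 2, a.1.1)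
  else if a.1 ∈ returnCodes p f t then (0, 1, a.1.2.2)
  else (agdStep blk f p.η a.1.1, a.1.2)

theorem measurableSet_perturbCodes (hg : Continuous (gradient f)) (t : ℕ) :
    MeasurableSet (perturbCodes p blk f t) :=
  (measurableSet_le ((continuous_agdGradSq hg p.η).measurable.comp measurable_fst)
    measurable_const).inter (measurable_snd.fst MeasurableSet.of_discrete)

theorem measurableSet_returnCodes (hf : Continuous f) (t : ℕ) :
    MeasurableSet (returnCodes p f t) :=
  (measurableSet_lt measurable_const ((hf.measurable.comp measurable_fst).sub
    (hf.measurable.comp measurable_snd.snd))).inter (measurable_snd.fst MeasurableSet.of_discrete)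

theorem measurable_iterCode (hf : Continuous f) (hg : Continuous (gradient f)) (t : ℕ) :
    Measurable (iterCode p blk f t) := by
  have hstep := (continuous_agdStep (blk := blk) hg p.η).measurable
  refine Measurable.ite (measurable_fst.snd.fst (measurableSet_singleton 1)) measurable_fst
    (Measurable.ite (measurable_fst (measurableSet_perturbCodes hg t)) ?_
      (Measurable.ite (measurable_fst (measurableSet_returnCodes hf t)) ?_ ?_))
  all_goals fun_prop

theorem runCode_inl_mem_perturbCodes :
    runCode (Sum.inl s) ∈ perturbCodes p blk f t ↔
      agdGradSq blk f p.η s.x ≤ p.gth ^ 2 ∧ s.IsIdle p t := by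
  obtain ⟨x, _ | ⟨tp, xt⟩⟩ := s
  · simp [runCode, perturbCodes, PAGDState.IsIdle]
  · simp [runCode, perturbCodes, PAGDState.IsIdle, add_right_comm tp 2]

theorem runCode_pagdIter (htth : ⌈p.tth⌉₊ ≠ 0) (y : EuclideanSpace ℝ (Fin d)) :
    runCode (pagdIter p blk f t y s) = iterCode p blk f t (runCode (Sum.inl s), y) := by
  by_cases hpert : agdGradSq blk f p.η s.x ≤ p.gth ^ 2 ∧ s.IsIdle p t
  · rw [pagdIter_of_perturb htth hpert.2 hpert.1, iterCode,
      if_pos (runCode_inl_mem_perturbCodes.2 hpert)]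
    obtain ⟨x, _ | ⟨tp, xt⟩⟩ := s <;> simp [runCode]
  have hcode := mt runCode_inl_mem_perturbCodes.1 hpert
  obtain ⟨x, _ | ⟨tp, xt⟩⟩ := s
  · rw [pagdIter_of_step hpert (by simp)]
    rw [runCode] at hcode
    simp [iterCode, hcode, runCode, returnCodes]
  rw [runCode] at hcode
  by_cases hreturn : t = tp + ⌈p.tth⌉₊ ∧ -p.fth < f x - f xt
  · rw [pagdIter_of_return hreturn.1 hreturn.2]
    have hmem : (x, tp + 2, xt) ∈ returnCodes p f t :=
      ⟨hreturn.2, Nat.le_add_left 2 tp, by rw [hreturn.1, add_right_comm]⟩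
    simp [iterCode, runCode, hcode, hmem]
  · have htest (ht : t = tp + ⌈p.tth⌉₊) : f x - f xt ≤ -p.fth :=
      not_lt.1 fun hx => hreturn ⟨ht, hx⟩
    rw [pagdIter_of_step (s := ⟨x, some (tp, xt)⟩) hpert (by simpa using htest)]
    have hmem : (x, tp + 2, xt) ∉ returnCodes p f t := fun ⟨hx, _, ht⟩ =>
      hreturn ⟨by simpa only [add_right_comm tp 2, Nat.add_right_cancel_iff] using ht, hx⟩
    simp [iterCode, runCode, hcode, hmem]

theorem runCode_pagdRun_succ (htth : ⌈p.tth⌉₊ ≠ 0) (ξ : ℕ → EuclideanSpace ℝ (Fin d)) (t : ℕ) :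
    runCode (pagdRun p blk f x₀ ξ (t + 1)) =
      iterCode p blk f t (runCode (pagdRun p blk f x₀ ξ t), ξ t) := by
  rw [pagdRun]
  rcases pagdRun p blk f x₀ ξ t with s | y
  · exact runCode_pagdIter htth (ξ t)
  · simp [runCode, iterCode]

theorem exists_perturbsAt_iff_runCode_mem {ξ : ℕ → EuclideanSpace ℝ (Fin d)} :
    (∃ x, PerturbsAt p blk f x₀ ξ t x) ↔
      runCode (pagdRun p blk f x₀ ξ t) ∈ perturbCodes p blk f t := by
  constructor
  · rintro ⟨_, hx, s, hs, hidle, rfl⟩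
    exact hs ▸ runCode_inl_mem_perturbCodes.2 ⟨hx, hidle⟩
  · intro h
    cases hs : pagdRun p blk f x₀ ξ t with
    | inl s =>
      obtain ⟨hx, hidle⟩ := runCode_inl_mem_perturbCodes.1 (hs ▸ h)
      exact ⟨s.x, hx, s, hs, hidle, rfl⟩
    | inr y => simp [hs, runCode, perturbCodes] at h

theorem PerturbsAt.runCode_fst {ξ : ℕ → EuclideanSpace ℝ (Fin d)}
    (hx : PerturbsAt p blk f x₀ ξ t x) : (runCode (pagdRun p blk f x₀ ξ t)).1 = x := by
  obtain ⟨-, ⟨x, _ | ⟨tp, xt⟩⟩, hs, -, rfl⟩ := hx <;> rw [hs, runCode]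

theorem pagdRun_congr {ξ ξ' : ℕ → EuclideanSpace ℝ (Fin d)} (h : ∀ i < t, ξ i = ξ' i) :
    pagdRun p blk f x₀ ξ t = pagdRun p blk f x₀ ξ' t := by
  induction t with
  | zero => rfl
  | succ t ih =>
    rw [pagdRun, pagdRun, ih fun i hi => h i (hi.trans t.lt_succ_self), h t t.lt_succ_self]

end Code

section Noise

variable {d : ℕ} {p : PAGDParams} {blk : Fin d → Fin 2} {f : EuclideanSpace ℝ (Fin d) → ℝ}
  {x₀ : EuclideanSpace ℝ (Fin d)} {Ω : Type*} [MeasurableSpace Ω] {P : Measure Ω}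
  {ξ : ℕ → Ω → EuclideanSpace ℝ (Fin d)}

theorem measurable_runCode_pagdRun (htth : ⌈p.tth⌉₊ ≠ 0) (hf : Continuous f)
    (hg : Continuous (gradient f)) (hξ : ∀ t, Measurable (ξ t)) (t : ℕ) :
    Measurable fun ω => runCode (pagdRun p blk f x₀ (ξ · ω) t) := by
  induction t with
  | zero => exact measurable_const
  | succ t ih =>
    simp only [runCode_pagdRun_succ htth]
    exact (measurable_iterCode hf hg t).comp (ih.prodMk (hξ t))

theorem indepFun_runCode_pagdRun (htth : ⌈p.tth⌉₊ ≠ 0) (hf : Continuous f)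
    (hg : Continuous (gradient f)) (hξ : ∀ t, Measurable (ξ t)) (hind : iIndepFun ξ P) (t : ℕ) :
    IndepFun (fun ω => runCode (pagdRun p blk f x₀ (ξ · ω) t)) (ξ t) P := by
  classical
  let extend : ℕ → (Finset.range t → EuclideanSpace ℝ (Fin d)) → EuclideanSpace ℝ (Fin d) :=
    fun i y => if hi : i ∈ Finset.range t then y ⟨i, hi⟩ else 0
  have hextend : ∀ i, Measurable (extend i) := fun i => by
    by_cases hi : i ∈ Finset.range t
    · simpa only [extend, dif_pos hi] using measurable_pi_apply _
    · simpa only [extend, dif_neg hi] using measurable_const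
  have hpast := (hind.indepFun_finset (Finset.range t) {t} (by simp) hξ).comp
    (measurable_runCode_pagdRun (p := p) (blk := blk) (x₀ := x₀) htth hf hg hextend t)
    (measurable_pi_apply (⟨t, Finset.mem_singleton_self t⟩ : ({t} : Finset ℕ)))
  refine hpast.congr (.of_forall fun ω => congrArg runCode (pagdRun_congr fun i hi => ?_)) .rfl
  simp [extend, hi]

theorem measurableSet_exists_perturbsAt (htth : ⌈p.tth⌉₊ ≠ 0) (hf : Continuous f)
    (hg : Continuous (gradient f)) (hξ : ∀ t, Measurable (ξ t)) (t : ℕ) :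
    MeasurableSet {ω | ∃ x, PerturbsAt p blk f x₀ (ξ · ω) t x} := by
  simp only [exists_perturbsAt_iff_runCode_mem]
  exact measurable_runCode_pagdRun htth hf hg hξ t (measurableSet_perturbCodes hg t)

theorem measure_perturbsAt_and_mem_le [IsProbabilityMeasure P] (htth : ⌈p.tth⌉₊ ≠ 0)
    (hf : Continuous f) (hg : Continuous (gradient f)) (hξ : ∀ t, Measurable (ξ t))
    (hind : iIndepFun ξ P) {B : Set (EuclideanSpace ℝ (Fin d) × EuclideanSpace ℝ (Fin d))}
    (hB : MeasurableSet B) (c : ENNReal) (t : ℕ) :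
    P {ω | ∃ x, PerturbsAt p blk f x₀ (ξ · ω) t x ∧ P.map (ξ t) (Prod.mk x ⁻¹' B) ≤ c ∧
        (x, ξ t ω) ∈ B} ≤ c * P {ω | ∃ x, PerturbsAt p blk f x₀ (ξ · ω) t x} := by
  have : IsProbabilityMeasure (P.map (ξ t)) :=
    Measure.isProbabilityMeasure_map (hξ t).aemeasurable
  let D := perturbCodes p blk f t ∩ {a | P.map (ξ t) (Prod.mk a.1 ⁻¹' B) ≤ c}
  let B' := (fun a : (EuclideanSpace ℝ (Fin d) × ℕ × EuclideanSpace ℝ (Fin d)) ×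
    EuclideanSpace ℝ (Fin d) => (a.1.1, a.2)) ⁻¹' B
  have hD : MeasurableSet D := (measurableSet_perturbCodes hg t).inter (measurableSet_le
    ((measurable_measure_prodMk_left hB).comp measurable_fst) measurable_const)
  have hB' : MeasurableSet B' := (measurable_fst.fst.prodMk measurable_snd) hB
  let Y := fun ω => runCode (pagdRun p blk f x₀ (ξ · ω) t)
  calc _ ≤ P {ω | Y ω ∈ D ∧ (Y ω, ξ t ω) ∈ B'} := by
        refine measure_mono ?_
        rintro ω ⟨_, hx, hc, hmem⟩
        obtain rfl := hx.runCode_fst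
        exact ⟨⟨exists_perturbsAt_iff_runCode_mem.1 ⟨_, hx⟩, hc⟩, hmem⟩
    _ ≤ c * P {ω | Y ω ∈ D} := measure_mem_and_mem_le_of_indepFun
        (measurable_runCode_pagdRun htth hf hg hξ t) (hξ t)
        (indepFun_runCode_pagdRun htth hf hg hξ hind t) hD hB' fun s hs => hs.2
    _ ≤ _ := by
        gcongr
        exact fun hω => exists_perturbsAt_iff_runCode_mem.2 hω.1

namespace RunRegular

open Classical in
theorem tsum_measure_exists_perturbsAt_le [IsProbabilityMeasure P] (hR : RunRegular p blk f)
    (hf : Continuous f) (hg : Continuous (gradient f)) {fstar : ℝ} (hfstar : ∀ y, fstar ≤ f y)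
    (hξ : ∀ t, Measurable (ξ t)) :
    ∑' t, P {ω | ∃ x, PerturbsAt p blk f x₀ (ξ · ω) t x} ≤
      ENNReal.ofReal ((f x₀ - fstar) / p.fth + 1) := by
  refine (tsum_measure_le_of_count_le
    (measurableSet_exists_perturbsAt hR.ceil_tth_ne_zero hf hg hξ) fun ω n => ?_).trans_eq
    (by rw [measure_univ, mul_one])
  rw [← ENNReal.ofReal_natCast]
  exact ENNReal.ofReal_le_ofReal (hR.perturbCount_le hfstar n)

theorem measure_exists_perturbsAt_and_mem_le [IsProbabilityMeasure P] (hR : RunRegular p blk f)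
    (hf : Continuous f) (hg : Continuous (gradient f)) {fstar : ℝ} (hfstar : ∀ y, fstar ≤ f y)
    (hξ : ∀ t, Measurable (ξ t)) (hind : iIndepFun ξ P)
    {B : Set (EuclideanSpace ℝ (Fin d) × EuclideanSpace ℝ (Fin d))} (hB : MeasurableSet B)
    (c : ENNReal) :
    P {ω | ∃ t x, PerturbsAt p blk f x₀ (ξ · ω) t x ∧ P.map (ξ t) (Prod.mk x ⁻¹' B) ≤ c ∧
        (x, ξ t ω) ∈ B} ≤ c * ENNReal.ofReal ((f x₀ - fstar) / p.fth + 1) := by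
  rw [Set.ofPred_exists]
  calc _ ≤ ∑' t, c * P {ω | ∃ x, PerturbsAt p blk f x₀ (ξ · ω) t x} :=
        (measure_iUnion_le _).trans <| ENNReal.tsum_le_tsum
          (measure_perturbsAt_and_mem_le hR.ceil_tth_ne_zero hf hg hξ hind hB c)
    _ ≤ _ := by
        rw [ENNReal.tsum_mul_left]
        gcongr
        exact hR.tsum_measure_exists_perturbsAt_le hf hg hfstar hξ

end RunRegular

end Noise

section Probability

variable {d : ℕ} {p : PAGDParams} {blk : Fin d → Fin 2} {f : EuclideanSpace ℝ (Fin d) → ℝ}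
  {Lb Lt : Fin 2 → ℝ} {fstar : ℝ} {x₀ x : EuclideanSpace ℝ (Fin d)}

theorem IsBlockSmooth.runRegular (h : IsBlockSmooth blk f Lb Lt) (hp : p.Admissible)
    (hLmax : p.Lmax = blockLmax Lb Lt) : RunRegular p blk f := by
  have hη := hp.η_pos
  have hstep := h.agdStep_le hη.le (by linarith [hLmax ▸ hp.η_mul_Lmax_le])
  have hceil : (1 : ℝ) ≤ ⌈p.tth⌉₊ := by
    exact_mod_cast (show 1 ≤ 16 by norm_num).trans hp.le_ceil_tth
  have hpace : p.pace ≤ p.η / 2 * p.gth ^ 2 :=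
    calc p.pace ≤ p.fth / 2 := by
          have := hp.fth_pos
          rw [PAGDParams.pace]
          gcongr
          linarith
      _ = p.η / 2 * p.gth ^ 2 := by rw [hp.fth_eq]; ring
  refine ⟨hp.fth_pos, by exact_mod_cast (zero_lt_one.trans_le hceil).ne', fun x => ?_,
    fun x hx => (hstep x).trans ?_⟩
  · have : 0 ≤ agdGradSq blk f p.η x := by rw [agdGradSq]; positivity
    exact (hstep x).trans (sub_le_self _ (by positivity))
  · have := mul_le_mul_of_nonneg_left hx.le (half_pos hη).le
    linarith

theorem PAGDParams.Admissible.exists_curvature_le (hp : p.Admissible)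
    (hLmax : p.Lmax = blockLmax Lb Lt) (h : IsBlockSmooth blk f Lb Lt)
    (hx : agdGradSq blk f p.η x ≤ p.gth ^ 2)
    (hnot : ¬IsSS2 f p.ε p.γ x) : ∃ v, ‖v‖ = 1 ∧ ⟪v, hessian f x v⟫ ≤ -p.γ := by
  have hgrad := h.norm_gradient_le hp.η_pos.le (by linarith [hLmax ▸ hp.η_mul_Lmax_le])
    hp.gth_pos.le hx
  exact exists_unit_of_not_isSS2 (by linarith [hp.gth_le, hp.ε_pos]) hnot

theorem RunRegular.fth_le_of_perturbsAt (hR : RunRegular p blk f) (hp : p.Admissible)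
    (hH : IsHessianLipschitz f p.ρ) (hfstar : ∀ y, fstar ≤ f y)
    {ξ : ℕ → EuclideanSpace ℝ (Fin d)} {t : ℕ} (hx : PerturbsAt p blk f x₀ ξ t x)
    {v : EuclideanSpace ℝ (Fin d)} (hv : ‖v‖ = 1) (hvH : ⟪v, hessian f x v⟫ ≤ -p.γ) :
    p.fth ≤ f x₀ - fstar := by
  have hpace : 0 ≤ p.pace * t := by
    have := hR.fth_pos
    rw [PAGDParams.pace]
    positivity
  linarith [fth_le_sub_of_curvature_le hp hH hfstar hv hvH,
    (hR.perturbCount_mul_le_of_perturbsAt hx).2]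

variable {Ω : Type*} [MeasurableSpace Ω] {P : Measure Ω} [IsProbabilityMeasure P]
  {ξ : ℕ → Ω → EuclideanSpace ℝ (Fin d)}

theorem measure_exists_perturbsAt_not_isSS2_le (hp : p.Admissible) (hd : p.d = d)
    (hLmax : p.Lmax = blockLmax Lb Lt) (h : IsBlockSmooth blk f Lb Lt)
    (hH : IsHessianLipschitz f p.ρ) (hfstar : ∀ y, fstar ≤ f y) (hΔ : p.Δ = f x₀ - fstar)
    (hξ : ∀ t, Measurable (ξ t)) (hind : iIndepFun ξ P)
    (hlaw : ∀ t, P.map (ξ t) = uniformBall d p.r) :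
    P {ω | ∃ t x, PerturbsAt p blk f x₀ (ξ · ω) t x ∧ ¬IsSS2 f p.ε p.γ x ∧
        (x, ξ t ω) ∈ stuckPairs p blk f} ≤ ENNReal.ofReal p.δ := by
  have hR := h.runRegular hp hLmax
  have hf := h.1.continuous
  have hg := hH.2.1.continuous
  by_cases hfth : p.fth ≤ p.Δ
  · obtain ⟨m, hm, hmΔ, hmδ⟩ := hp.exists_translate_count hfth
    calc _ ≤ P {ω | ∃ t x, PerturbsAt p blk f x₀ (ξ · ω) t x ∧
          P.map (ξ t) (Prod.mk x ⁻¹' stuckPairs p blk f) ≤ ENNReal.ofReal (3 / m) ∧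
          (x, ξ t ω) ∈ stuckPairs p blk f} := by
          refine measure_mono ?_
          rintro ω ⟨t, x, hx, hnot, hstuck⟩
          obtain ⟨v, hv, hvH⟩ := hp.exists_curvature_le hLmax h hx.1 hnot
          exact ⟨t, x, hx, hlaw t ▸ uniformBall_preimage_stuckPairs_le hp hd hLmax h hH
            (hp.fth_pos.trans_le hfth) hm hmΔ hx.1 hv hvH, hstuck⟩
      _ ≤ ENNReal.ofReal (3 / m) * ENNReal.ofReal ((f x₀ - fstar) / p.fth + 1) :=
          hR.measure_exists_perturbsAt_and_mem_le hf hg hfstar hξ hind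
            (measurableSet_stuckPairs p hf hg) _
      _ ≤ ENNReal.ofReal p.δ := by
          rw [← ENNReal.ofReal_mul (by positivity), ← hΔ]
          exact ENNReal.ofReal_le_ofReal hmδ
  · refine (measure_mono_null (t := ∅) ?_ measure_empty).trans_le zero_le
    rintro ω ⟨t, x, hx, hnot, -⟩
    obtain ⟨v, hv, hvH⟩ := hp.exists_curvature_le hLmax h hx.1 hnot
    exact hfth (hΔ ▸ hR.fth_le_of_perturbsAt hp hH hfstar hx hv hvH)

theorem ofReal_one_sub_le_measure_returns_isSS2 (hp : p.Admissible) (hd : p.d = d)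
    (hLmax : p.Lmax = blockLmax Lb Lt) (h : IsBlockSmooth blk f Lb Lt)
    (hH : IsHessianLipschitz f p.ρ) (hfstar : ∀ y, fstar ≤ f y) (hΔ : p.Δ = f x₀ - fstar)
    (hind : iIndepFun ξ P) (hlaw : ∀ t, HasLaw (ξ t) (uniformBall d p.r) P) :
    ENNReal.ofReal (1 - p.δ) ≤ P {ω | ∃ (T : ℕ) (x : EuclideanSpace ℝ (Fin d)),
      pagdRun p blk f x₀ (ξ · ω) T = Sum.inr x ∧ IsSS2 f p.ε p.γ x ∧
        (T : ℝ) ≤ (⌈p.tth⌉₊ + 1) * (p.Δ / p.fth + 1)} := by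
  set G := {ω | ∃ (T : ℕ) (x : EuclideanSpace ℝ (Fin d)), _ ∧ _}
  choose ζ hζ_meas hζ using fun t => (hlaw t).aemeasurable
  have hbad := measure_exists_perturbsAt_not_isSS2_le hp hd hLmax h hH hfstar hΔ
    hζ_meas (hind.congr hζ) (fun t => (Measure.map_congr (hζ t)).symm.trans (hlaw t).map_eq)
  have hGc : P Gᶜ ≤ ENNReal.ofReal p.δ := by
    refine (measure_mono_ae ?_).trans hbad
    filter_upwards [ae_all_iff.2 hζ] with ω hω hωG
    obtain ⟨T, hT, tp, x, hreturn, hx, hstuck⟩ :=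
      (h.runRegular hp hLmax).exists_returnsStuck hfstar x₀ (ξ · ω)
    have hωζ : (ξ · ω) = (ζ · ω) := funext hω
    exact ⟨tp, x, hωζ ▸ hx, fun hSS => hωG ⟨T, x, hreturn, hSS, hΔ ▸ hT⟩,
      congrFun hωζ tp ▸ hstuck⟩
  rw [ENNReal.ofReal_sub _ hp.δ_pos.le, ENNReal.ofReal_one, tsub_le_iff_right,
    ← measure_univ (μ := P)]
  exact (measure_univ_le_add_compl G).trans (by gcongr)

end Probability

theorem theorem1_general {c : ℝ} (hc : 0 < c) (hcmax : c ≤ 1 / 10000) {d : ℕ} (hd : 0 < d)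
    {blk : Fin d → Fin 2} {f : EuclideanSpace ℝ (Fin d) → ℝ} {L ρ : ℝ} {Lb Lt : Fin 2 → ℝ}
    (h : IsBlockSmooth blk f Lb Lt) (hH : IsHessianLipschitz f ρ) (hLmax : 0 < blockLmax Lb Lt)
    (hL : blockLmax Lb Lt ≤ L) (hρ : 0 < ρ) {fstar : ℝ} (hfstar : ∀ y, fstar ≤ f y)
    (x₀ : EuclideanSpace ℝ (Fin d)) {ε δ : ℝ} (hε : 0 < ε) (hεmax : ε ≤ blockLmax Lb Lt ^ 2 / ρ)
    (hδ : 0 < δ) (hδmax : δ ≤ 1) {p : PAGDParams}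
    (hp : p = { d := d, c := c, Lmax := blockLmax Lb Lt, L := L, ρ := ρ, ε := ε, δ := δ,
                Δ := f x₀ - fstar })
    {Ω : Type*} [MeasurableSpace Ω] {P : Measure Ω} [IsProbabilityMeasure P]
    {ξ : ℕ → Ω → EuclideanSpace ℝ (Fin d)} (hind : iIndepFun ξ P)
    (hlaw : ∀ t, HasLaw (ξ t) (uniformBall d p.r) P) :
    ENNReal.ofReal (1 - δ) ≤
      P {ω | ∃ (T : ℕ) (x : EuclideanSpace ℝ (Fin d)),
          pagdRun p blk f x₀ (fun t => ξ t ω) T = Sum.inr x ∧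
          IsSS2 f ε ((blockLmax Lb Lt * ρ * ε) ^ ((1 : ℝ) / 3)) x ∧
          (T : ℝ) ≤ iterationConst c * (p.rate * max p.logFactor 4 ^ 7 + p.tth) ∧
          (ε ^ 2 / blockLmax Lb Lt ≤ f x₀ - fstar →
            (T : ℝ) ≤ iterationConst c * (p.rate * p.logFactor ^ 7))} := by
  have hadm : p.Admissible := by
    subst hp
    exact ⟨hd, hc, hcmax, hLmax, hL, hρ, hε, hεmax, hδ, hδmax, sub_nonneg.2 (hfstar x₀)⟩
  subst hp
  refine (ofReal_one_sub_le_measure_returns_isSS2 hadm rfl rfl h hH hfstar rfl hind hlaw).trans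
    (measure_mono ?_)
  rintro ω ⟨T, x, hreturn, hSS, hT⟩
  exact ⟨T, x, hreturn, hSS, hadm.le_iterationConst_mul_rate_add_tth hT,
    fun hΔ => hadm.le_iterationConst_mul_rate hΔ hT⟩

theorem theorem1 :
    ∃ cmax : ℝ, 0 < cmax ∧ ∀ c : ℝ, 0 < c → c ≤ cmax →
      ∃ C : ℝ, 0 < C ∧
        ∀ (d : ℕ) (blk : Fin d → Fin 2), Function.Surjective blk →
        ∀ (f : EuclideanSpace ℝ (Fin d) → ℝ) (L ρ : ℝ) (Lb Lt : Fin 2 → ℝ),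
          IsLSmooth f L → IsBlockSmooth blk f Lb Lt → IsHessianLipschitz f ρ →
          0 < blockLmax Lb Lt → blockLmax Lb Lt ≤ L → 0 < ρ →
        ∀ (fstar : ℝ), IsGLB (Set.range f) fstar →
        ∀ (x₀ : EuclideanSpace ℝ (Fin d)) (ε δ : ℝ),
          0 < ε → ε ≤ blockLmax Lb Lt ^ 2 / ρ → 0 < δ → δ ≤ 1 →
        ∀ (p : PAGDParams),
          p = { d := d, c := c, Lmax := blockLmax Lb Lt, L := L, ρ := ρ, ε := ε, δ := δ,
                Δ := f x₀ - fstar } →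
        ∀ (Ω : Type*) [MeasurableSpace Ω] (P : Measure Ω) [IsProbabilityMeasure P]
          (ξ : ℕ → Ω → EuclideanSpace ℝ (Fin d)),
          iIndepFun ξ P → (∀ t, HasLaw (ξ t) (uniformBall d p.r) P) →
          ENNReal.ofReal (1 - δ) ≤
            P {ω | ∃ (T : ℕ) (x : EuclideanSpace ℝ (Fin d)),
                pagdRun p blk f x₀ (fun t => ξ t ω) T = Sum.inr x ∧
                IsSS2 f ε ((blockLmax Lb Lt * ρ * ε) ^ ((1 : ℝ) / 3)) x ∧
                (T : ℝ) ≤ C * (p.rate * max p.logFactor 4 ^ 7 + p.tth) ∧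
                (ε ^ 2 / blockLmax Lb Lt ≤ f x₀ - fstar →
                  (T : ℝ) ≤ C * (p.rate * p.logFactor ^ 7))} := by
  refine ⟨1 / 10000, by norm_num, fun c hc hcmax => ⟨iterationConst c, iterationConst_pos hc, ?_⟩⟩
  intro d blk hblk f L ρ Lb Lt _ h hH hLmax hL hρ fstar hfstar x₀ ε δ hε hεmax hδ hδmax p hp
    Ω _ P _ ξ
  exact theorem1_general hc hcmax (hblk 0).choose.pos h hH hLmax hL hρ
    (fun y => hfstar.1 ⟨y, rfl⟩) x₀ hε hεmax hδ hδmax hp
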